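/- Let $(a_n)_{n\ge1}$ be positive numbers with $a_n\to\infty$ and let $0<\xi<1$. Let $c_k>0$ and $0<\gamma_k<\gamma_{k+1}$ ($k\in\mathbb N=\{1,2,\dots\}$) satisfy, as $k\to\infty$, $$c_k=\frac{A}{k^{\alpha}}+O\left(k^{-\alpha-1}\right),\qquad \gamma_k=Bk^{\beta}+O\left(k^{\beta-1}\right),$$ with constants $A>0$, $B>0$, $0<\alpha\le1$, $\alpha+\beta>1$, and assume $\sum_{k=1}^\infty c_k/\gamma_k<1$. Assume also that for some integer $p\ge1$ the gaps satisfy $\gamma_{k+1}-\gamma_k\asymp k^{\beta-p}$ as $k\to\infty$ (each side is bounded by a positive constant times the other for all large $k$). Put $r=\frac{\alpha+\beta-1}{\beta}\in(0,1]$ and $$f_n(\zeta)=1-\frac1{a_n^{2(1-\xi)}}\sum_{k=1}^\infty\frac{c_k}{\zeta+\gamma_k},\qquad \ell_n(\zeta)=\zeta^2+a_n^2f_n(\zeta).$$ Then for all sufficiently large $n$ the real zeros of $f_n$ form a sequence $(x_{n,k})_{k\ge1}$, and the set of zeros of the meromorphic function $\ell_n$ in $\mathbb C$ consists of a sequence of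 real zeros $(\lambda_{n,k})_{k\ge1}$ with $$\cdots<-\gamma_k<\lambda_{n,k}<x_{n,k}<-\gamma_{k-1}<\lambda_{n,k-1}<x_{n,k-1}<\cdots<-\gamma_1<\lambda_{n,1}<x_{n,1}<0,$$ together with one pair of non-real complex-conjugate zeros $\lambda_n^{\pm}$, where $\lambda_n^+=\overline{\lambda_n^-}$ and $\operatorname{Im}\lambda_n^+>0$. As $n\to\infty$ this pair satisfies, with $D^+=D$ and $D^-=\overline D$, $$\lambda_n^\pm=\pm ia_n-\frac{D^{\pm}A}{\beta B^{1-r}}\,\frac1{a_n^{1+r-2\xi}}+O\left(\frac1{a_n^{2(r-\xi)+1}}\right)\quad\text{if }0<r<\tfrac12,$$ $$\lambda_n^\pm=\pm ia_n-\frac{D^{\pm}A}{\beta B^{1-r}}\,\frac1{a_n^{1+r-2\xi}}+O\left(\frac1{a_n^{2(1-\xi)}}\right)\quad\text{if }\tfrac12\le r<1,$$ $$\lambda_n^\pm=\pm ia_n-\frac{A}{2\beta}\,\frac{\ln a_n}{a_n^{2(1-\xi)}}+O\left(\frac1{a_n^{2(1-\xi)}}\right)\quad\text{if }r=1,$$ where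 for $0<r<1$ $$D=\frac i2\int_0^\infty\frac{dt}{t^r(i+t)}=\frac12\left(\int_0^\infty\frac{dt}{t^r(1+t^2)}+i\int_0^\infty\frac{dt}{t^{r-1}(1+t^2)}\right)=\frac\pi2\,\frac{e^{i\frac{\pi}{2}(1-r)}}{\sin(\pi r)}.$$ -/

import Mathlib

open Filter Asymptotics

namespace GurtinPipkin

/-! Sequences are indexed from `0`: `c k` and `γ k` are the `(k+1)`-st terms. -/

/-- The Laplace transform of the kernel: `∑ c_k / (ζ + γ_k)`. -/
noncomputable def Khat (c γ : ℕ → ℝ) (ζ : ℂ) : ℂ :=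
  ∑' k : ℕ, (c k : ℂ) / (ζ + (γ k : ℂ))

/-- `f(ζ) = 1 - a^{-2(1-ξ)} ∑ c_k / (ζ + γ_k)`. -/
noncomputable def fSym (a ξ : ℝ) (c γ : ℕ → ℝ) (ζ : ℂ) : ℂ :=
  1 - 1 / ((a ^ (2 * (1 - ξ)) : ℝ) : ℂ) * Khat c γ ζ

/-- `ℓ(ζ) = ζ² + a² (1 - a^{-2(1-ξ)} ∑ c_k / (ζ + γ_k))`. -/
noncomputable def ell (a ξ : ℝ) (c γ : ℕ → ℝ) (ζ : ℂ) : ℂ :=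
  ζ ^ 2 + (a : ℂ) ^ 2 * fSym a ξ c γ ζ

/-- The zeros of a function that is meromorphic with its poles at the points `-γ_k`;
the formulas above carry no meaning at the poles, which are therefore left out. -/
def zerosOff (γ : ℕ → ℝ) (F : ℂ → ℂ) : Set ℂ :=
  {ζ | (∀ k, ζ ≠ -(γ k : ℂ)) ∧ F ζ = 0}

/-- `D = (i/2) ∫₀^∞ dt / (t^r (i + t))`. -/
noncomputable def constD (r : ℝ) : ℂ :=
  Complex.I / 2 * ∫ t in Set.Ioi (0 : ℝ), 1 / (((t ^ r : ℝ) : ℂ) * (Complex.I + (t : ℂ)))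

end GurtinPipkin

/-! Write `K` for `Khat c γ`, `s = a^(-2(1-ξ))` and `b = a² s = a^(2ξ)`, so that `f = 1 - sK` and
`ℓ(z) = z² + a² - bK(z)`.

Zeros. All residues of `K` are positive, so `K` is real only on the real line and decreases between
consecutive poles. Hence `1 - bK` has only real zeros, one per interval, whenever `b K(0) < 1`
(`exists_zeros_one_sub_Khat`). The function `ℓ` is reduced to this case: once a non-real zero `w` is
known, partial fractions give `ℓ(z) = (z - w)(z - conj w)(1 - bK₁(z))`, where `K₁` has the positive
weights `c_k / |w + γ_k|²` (`quadratic_sub_Khat_eq_mul`). Evaluation at `0` shows `b K₁(0) < 1`. At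
a real zero of `ℓ` one has `a² f = -z² < 0`, which places it to the left of the zero of `f` in the
same interval.

The non-real zero. With `z = ia + δ` the equation `ℓ(z) = 0` reads `δ = (bK(ia + δ) - δ²) / (2ia)`,
a contraction for large `a`. It gives `w = ia + bK(ia)/(2ia)` up to `O(b² |K(ia)|² / a³)`
(`exists_zero_near_I_mul`).

Asymptotics. It remains to expand `K(ia)` up to `O(1/a)`. The sum is replaced by `A ∫₁^∞ x^(-α) /
(ia + B x^β) dx`. For `α < 1` the integral extends to `(0, ∞)` and scales to a multiple of `a^(-r)`
containing `D`; for `α = 1` it has a logarithmic primitive. A Beta integral evaluates `D`. -/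

namespace GurtinPipkin

/-! ### Real zeros of `1 - bK` between consecutive poles. -/

/-- The points of the `k`-th interval of the real line cut out by the poles `-γ j`, counted from
the right; the interval with index `0` is unbounded. -/
def poleInterval (γ : ℕ → ℝ) (k : ℕ) : Set ℝ := {t | -γ k < t ∧ ∀ j < k, t < -γ j}

/-- The restriction of `Khat` to the real line. -/
noncomputable def realKhat (c γ : ℕ → ℝ) (t : ℝ) : ℝ := ∑' k, c k / (t + γ k)

theorem Khat_ofReal (c γ : ℕ → ℝ) (t : ℝ) : Khat c γ t = (realKhat c γ t : ℂ) := by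
  simp only [Khat, realKhat, Complex.ofReal_tsum]
  push_cast
  rfl

section Series

variable {c γ : ℕ → ℝ} (hc : ∀ k, 0 < c k) (hγ : ∀ k, 0 < γ k) (hm : StrictMono γ)
  (ht : Tendsto γ atTop atTop) (hs : Summable fun k => c k / γ k)

/-- As soon as `γ k ≥ 2‖z‖`, the denominator has norm at least `γ k / 2`. The finitely many other
terms are irrelevant, so `z` may even be a pole. -/
theorem summable_norm_div (hc : ∀ k, 0 < c k) (ht : Tendsto γ atTop atTop)
    (hs : Summable fun k => c k / γ k) (z : ℂ) :
    Summable fun k => ‖(c k : ℂ) / (z + (γ k : ℂ))‖ := by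
  refine Summable.of_norm_bounded_eventually_nat (g := fun k => 2 * (c k / γ k)) (hs.mul_left 2) ?_
  filter_upwards [ht.eventually_ge_atTop (2 * ‖z‖), ht.eventually_gt_atTop 0] with k hk hk0
  have h1 : γ k ≤ ‖z + (γ k : ℂ)‖ + ‖z‖ := by
    have := norm_sub_le (z + (γ k : ℂ)) z
    rw [add_sub_cancel_left, Complex.norm_real, Real.norm_of_nonneg hk0.le] at this
    exact this
  rw [norm_norm, norm_div, Complex.norm_real, Real.norm_of_nonneg (hc k).le, ← mul_div_assoc,
    div_le_div_iff₀ (by linarith) hk0]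
  nlinarith [hc k]

theorem summable_div (hc : ∀ k, 0 < c k) (ht : Tendsto γ atTop atTop)
    (hs : Summable fun k => c k / γ k) (z : ℂ) :
    Summable fun k => (c k : ℂ) / (z + (γ k : ℂ)) :=
  (summable_norm_div hc ht hs z).of_norm

theorem summable_real_div (hc : ∀ k, 0 < c k) (ht : Tendsto γ atTop atTop)
    (hs : Summable fun k => c k / γ k) (t : ℝ) :
    Summable fun k => c k / (t + γ k) := by
  have := summable_div hc ht hs t
  rw [← Complex.summable_ofReal]
  simpa using this

theorem poleInterval_add_pos (hm : StrictMono γ) {k : ℕ} {t : ℝ} (h : t ∈ poleInterval γ k)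
    {j : ℕ} (hj : k ≤ j) : 0 < t + γ j := by
  have := hm.monotone hj
  linarith [h.1]

theorem poleInterval_add_neg {k : ℕ} {t : ℝ} (h : t ∈ poleInterval γ k)
    {j : ℕ} (hj : j < k) : t + γ j < 0 := by
  linarith [h.2 j hj]

theorem poleInterval_add_ne_zero (hm : StrictMono γ) {k : ℕ} {t : ℝ} (h : t ∈ poleInterval γ k)
    (j : ℕ) : t + γ j ≠ 0 := by
  rcases lt_or_ge j k with hj | hj
  · exact (poleInterval_add_neg h hj).ne
  · exact (poleInterval_add_pos hm h hj).ne'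

theorem poleInterval_ordConnected {k : ℕ} : (poleInterval γ k).OrdConnected :=
  ⟨fun _ hx _ hy _ hz => ⟨hx.1.trans_le hz.1, fun j hj => hz.2.trans_lt (hy.2 j hj)⟩⟩

/-- Every real number that is not a pole lies in one of the intervals. -/
theorem exists_mem_poleInterval (ht : Tendsto γ atTop atTop) {t : ℝ} (h : ∀ k, t ≠ -γ k) :
    ∃ k, t ∈ poleInterval γ k := by
  classical
  have hex : ∃ k, -γ k < t := by
    obtain ⟨k, hk⟩ := (ht.eventually_gt_atTop (-t)).exists
    exact ⟨k, by linarith⟩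
  exact ⟨Nat.find hex, Nat.find_spec hex,
    fun j hj => lt_of_le_of_ne (not_lt.1 (Nat.find_min hex hj)) (h j)⟩

/-- No denominator changes sign inside a pole interval, so every single term is decreasing there,
those with negative denominators included. -/
theorem div_add_lt (hc : ∀ k, 0 < c k) (hm : StrictMono γ) {k : ℕ} {s t : ℝ}
    (hsI : s ∈ poleInterval γ k)
    (htI : t ∈ poleInterval γ k) (hst : s < t) (j : ℕ) : c j / (t + γ j) < c j / (s + γ j) := by
  rcases lt_or_ge j k with hj | hj
  · have h1 := poleInterval_add_neg hsI hj
    have h2 := poleInterval_add_neg htI hj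
    have := div_lt_div_of_pos_left (hc j) (neg_pos.2 h2) (by linarith : -(t + γ j) < -(s + γ j))
    rw [div_neg, div_neg] at this
    linarith
  · exact div_lt_div_of_pos_left (hc j) (poleInterval_add_pos hm hsI hj) (by linarith)

theorem div_add_le (hc : ∀ k, 0 < c k) (hm : StrictMono γ) {k : ℕ} {s t : ℝ}
    (hsI : s ∈ poleInterval γ k)
    (htI : t ∈ poleInterval γ k) (hst : s ≤ t) (j : ℕ) : c j / (t + γ j) ≤ c j / (s + γ j) := by
  rcases hst.eq_or_lt with rfl | h
  · exact le_rfl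
  · exact (div_add_lt hc hm hsI htI h j).le

include hc hm ht hs in
theorem realKhat_strictAntiOn (k : ℕ) : StrictAntiOn (realKhat c γ) (poleInterval γ k) :=
  fun _ hx _ hy hxy => Summable.tsum_lt_tsum (i := 0)
    (fun j => (div_add_lt hc hm hx hy hxy j).le) (div_add_lt hc hm hx hy hxy 0)
    (summable_real_div hc ht hs _) (summable_real_div hc ht hs _)

include hc hm ht hs in
-- Each term is monotone on `[u, v]`, hence lies between its two endpoint values; these give a
-- summable majorant and uniform convergence.
theorem realKhat_continuousOn {k : ℕ} {u v : ℝ} (hu : u ∈ poleInterval γ k)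
    (hv : v ∈ poleInterval γ k) : ContinuousOn (realKhat c γ) (Set.Icc u v) := by
  have hsub : Set.Icc u v ⊆ poleInterval γ k := poleInterval_ordConnected.out hu hv
  refine continuousOn_tsum (u := fun j => |c j / (u + γ j)| + |c j / (v + γ j)|) (fun j => ?_)
    ((summable_real_div hc ht hs u).abs.add (summable_real_div hc ht hs v).abs) (fun j x hx => ?_)
  · exact continuousOn_const.div (by fun_prop)
      fun x hx => poleInterval_add_ne_zero hm (hsub hx) j
  · have h1 := div_add_le hc hm hu (hsub hx) hx.1 j
    have h2 := div_add_le hc hm (hsub hx) hv hx.2 j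
    rw [Real.norm_eq_abs, abs_le]
    constructor
    · linarith [neg_abs_le (c j / (v + γ j)), abs_nonneg (c j / (u + γ j))]
    · linarith [le_abs_self (c j / (u + γ j)), abs_nonneg (c j / (v + γ j))]

include hc hm ht hs in
/-- Inside one interval, `realKhat` minus one of its terms is decreasing. -/
theorem realKhat_sub_term_le {k : ℕ} {s t : ℝ} (hsI : s ∈ poleInterval γ k)
    (htI : t ∈ poleInterval γ k) (hst : s ≤ t) (i : ℕ) :
    realKhat c γ t - c i / (t + γ i) ≤ realKhat c γ s - c i / (s + γ i) := by
  classical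
  have hS := summable_real_div hc ht hs s
  have hT := summable_real_div hc ht hs t
  have h1 := (hS.sub hT).sum_le_tsum {i}
    (fun j _ => sub_nonneg.2 (div_add_le hc hm hsI htI hst j))
  rw [hS.tsum_sub hT] at h1
  simp only [Finset.sum_singleton] at h1
  simp only [realKhat]
  linarith

include hc hm ht hs in
-- Blow-up to `+∞` at the left end: the term with index `k` explodes near `-γ k`, while the rest,
-- being decreasing, stays above its value `R` at `v`.
theorem exists_lt_realKhat {k : ℕ} {v : ℝ} (hv : v ∈ poleInterval γ k) (M : ℝ) :
    ∃ u ∈ poleInterval γ k, u < v ∧ M < realKhat c γ u := by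
  set R := realKhat c γ v - c k / (v + γ k)
  have hvk : 0 < v + γ k := by linarith [hv.1]
  have hN : 0 < |M - R| + 1 := by positivity
  -- The first entry keeps the new point to the left of `v`; the second makes the singular term at
  -- least `|M - R| + 1`.
  set ε := min ((v + γ k) / 2) (c k / (|M - R| + 1))
  have hε : 0 < ε := lt_min (by linarith) (div_pos (hc k) hN)
  have hεv : ε < v + γ k := (min_le_left _ _).trans_lt (by linarith)
  have hu : -γ k + ε ∈ poleInterval γ k :=
    ⟨by linarith, fun j hj => by linarith [hv.2 j hj]⟩
  refine ⟨-γ k + ε, hu, by linarith, ?_⟩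
  have h1 := realKhat_sub_term_le hc hm ht hs hu hv (by linarith) k
  have h2 : |M - R| + 1 ≤ c k / (-γ k + ε + γ k) := by
    rw [show -γ k + ε + γ k = ε by ring, le_div_iff₀ hε]
    have := (le_div_iff₀ hN).1 (min_le_right ((v + γ k) / 2) (c k / (|M - R| + 1)))
    linarith
  linarith [le_abs_self (M - R)]

include hc hm ht hs in
-- Mirror image at the right end `-γ k` of the interval with index `k + 1`: the singular term tends
-- to `-∞` and the rest stays below its value at `u`.
theorem exists_realKhat_lt {k : ℕ} {u : ℝ} (hu : u ∈ poleInterval γ (k + 1)) (M : ℝ) :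
    ∃ v ∈ poleInterval γ (k + 1), u < v ∧ realKhat c γ v < M := by
  set R := realKhat c γ u - c k / (u + γ k)
  have huk : u + γ k < 0 := poleInterval_add_neg hu (Nat.lt_succ_self k)
  have hN : 0 < |R - M| + 1 := by positivity
  set ε := min (-(u + γ k) / 2) (c k / (|R - M| + 1))
  have hε : 0 < ε := lt_min (by linarith) (div_pos (hc k) hN)
  have hεv : ε < -(u + γ k) := (min_le_left _ _).trans_lt (by linarith)
  have hv : -γ k - ε ∈ poleInterval γ (k + 1) :=
    ⟨by linarith [hu.1], fun j hj => by
      have := hm.monotone (Nat.lt_succ_iff.1 hj)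
      linarith⟩
  refine ⟨-γ k - ε, hv, by linarith, ?_⟩
  have h1 := realKhat_sub_term_le hc hm ht hs hu hv (by linarith) k
  have h2 : |R - M| + 1 ≤ c k / ε := by
    rw [le_div_iff₀ hε]
    have := (le_div_iff₀ hN).1 (min_le_right (-(u + γ k) / 2) (c k / (|R - M| + 1)))
    linarith
  rw [show -γ k - ε + γ k = -ε by ring, div_neg] at h1
  linarith [le_abs_self (R - M)]

include hc ht hs in
/-- `Khat` maps the upper and the lower half plane into each other, hence takes real values only
on the real line. -/
theorem im_eq_zero_of_Khat_im {z : ℂ} (hz : (Khat c γ z).im = 0) : z.im = 0 := by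
  by_contra hne
  have hsum := summable_div hc ht hs z
  -- All terms have imaginary parts of the same strict sign, so nothing cancels.
  have him : ∀ k, ((c k : ℂ) / (z + (γ k : ℂ))).im = -z.im * (c k / Complex.normSq (z + γ k)) := by
    intro k
    rw [Complex.div_im]
    simp
    ring
  have hpos : ∀ k, 0 < c k / Complex.normSq (z + γ k) := fun k =>
    div_pos (hc k) (Complex.normSq_pos.2 fun h => hne (by simpa using congrArg Complex.im h))
  rw [Khat, Complex.im_tsum hsum, tsum_congr him, tsum_mul_left] at hz
  have hs2 : Summable fun k => c k / Complex.normSq (z + γ k) := by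
    have := (Complex.hasSum_im hsum.hasSum).summable
    simp only [him] at this
    exact (summable_mul_left_iff (neg_ne_zero.2 hne)).1 this
  have := hs2.tsum_pos (fun k => (hpos k).le) 0 (hpos 0)
  rcases mul_eq_zero.1 hz with h | h
  · exact hne (neg_eq_zero.1 h)
  · exact this.ne' h

include hc hγ hm ht hs in
/-- The zeros of `1 - b ∑ c_k / (ζ + γ_k)`: they are all real, and there is exactly one in each of
the intervals cut out by the poles, the rightmost one being negative. -/
theorem exists_zeros_one_sub_Khat {b : ℝ} (hb : 0 < b) (hb1 : b * ∑' k, c k / γ k < 1) :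
    ∃ x : ℕ → ℝ, zerosOff γ (fun z => 1 - (b : ℂ) * Khat c γ z) = Set.range (fun k => (x k : ℂ)) ∧
      (∀ k, x k ∈ poleInterval γ k) ∧ x 0 < 0 ∧
      ∀ k, ∀ t ∈ poleInterval γ k, 1 - b * realKhat c γ t < 0 → t < x k := by
  have hanti := realKhat_strictAntiOn hc hm ht hs
  have key : ∀ k, ∃ x ∈ poleInterval γ k, realKhat c γ x = 1 / b ∧ (k = 0 → x < 0) := by
    intro k
    -- Right end for the intermediate value theorem: in the unbounded interval `v = 0` works because
    -- of `hb1`; elsewhere a point close to the right pole does.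
    have : ∃ v ∈ poleInterval γ k, realKhat c γ v < 1 / b ∧ (k = 0 → v = 0) := by
      rcases k with _ | k
      · refine ⟨0, ⟨by linarith [hγ 0], by simp⟩, ?_, fun _ => rfl⟩
        rw [lt_div_iff₀ hb, mul_comm]
        simpa [realKhat] using hb1
      · have hlt : γ k < γ (k + 1) := hm (Nat.lt_succ_self k)
        obtain ⟨v, hv, -, h⟩ := exists_realKhat_lt hc hm ht hs
          (u := -(γ k + γ (k + 1)) / 2) (k := k)
          ⟨by linarith, fun j hj => by
            have := hm.monotone (Nat.lt_succ_iff.1 hj)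
            linarith⟩ (1 / b)
        exact ⟨v, hv, h, by simp⟩
    obtain ⟨v, hv, hvb, hv0⟩ := this
    obtain ⟨u, hu, huv, hub⟩ := exists_lt_realKhat hc hm ht hs hv (1 / b)
    obtain ⟨x, hx, hxb⟩ := intermediate_value_Ioo' huv.le
      (realKhat_continuousOn hc hm ht hs hu hv) ⟨hvb, hub⟩
    exact ⟨x, poleInterval_ordConnected.out hu hv ⟨hx.1.le, hx.2.le⟩, hxb,
      fun h => hx.2.trans_eq (hv0 h)⟩
  choose x hxI hxb hx0 using key
  refine ⟨x, ?_, hxI, hx0 0 rfl, fun k t htI h => ?_⟩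
  · ext z
    simp only [zerosOff, Set.mem_ofPred_eq, Set.mem_range]
    constructor
    · rintro ⟨hz, h⟩
      have hK : Khat c γ z = ((1 / b : ℝ) : ℂ) := by
        have : (b : ℂ) ≠ 0 := by exact_mod_cast hb.ne'
        push_cast
        rw [eq_div_iff this, mul_comm]
        exact (sub_eq_zero.1 h).symm
      have him := im_eq_zero_of_Khat_im hc ht hs (z := z) (by rw [hK, Complex.ofReal_im])
      obtain ⟨t, rfl⟩ : ∃ t : ℝ, z = t := ⟨z.re, Complex.ext rfl (by simpa using him)⟩
      obtain ⟨k, hk⟩ := exists_mem_poleInterval ht (t := t) fun k h => hz k (by rw [h]; simp)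
      refine ⟨k, ?_⟩
      rw [Khat_ofReal, Complex.ofReal_inj] at hK
      rw [(hanti k).injOn (hxI k) hk ((hxb k).trans hK.symm)]
    · rintro ⟨k, rfl⟩
      constructor
      · intro j h
        apply poleInterval_add_ne_zero hm (hxI k) j
        have h' : x k = -γ j := by exact_mod_cast h
        linarith
      · rw [Khat_ofReal, hxb]
        push_cast
        have : (b : ℂ) ≠ 0 := by exact_mod_cast hb.ne'
        field_simp
        simp
  · by_contra! hle
    have := (hanti k).antitoneOn (hxI k) htI hle
    rw [hxb, le_div_iff₀ hb] at this
    linarith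

end Series

/-! ### Splitting off a conjugate pair of zeros, and interlacing. -/

open ComplexConjugate

theorem ne_neg_ofReal_of_im_ne_zero {z : ℂ} (hz : z.im ≠ 0) (t : ℝ) : z ≠ -(t : ℂ) := by
  rintro rfl
  simp at hz

theorem add_ofReal_ne_zero {z : ℂ} (hz : z.im ≠ 0) (t : ℝ) : z + (t : ℂ) ≠ 0 := fun h =>
  ne_neg_ofReal_of_im_ne_zero hz t (eq_neg_of_add_eq_zero_left h)

theorem Khat_conj (c γ : ℕ → ℝ) (z : ℂ) : Khat c γ (conj z) = conj (Khat c γ z) := by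
  simp [Khat, Complex.conj_tsum]

section Factor

variable {c γ : ℕ → ℝ} (hc : ∀ k, 0 < c k) (hγ : ∀ k, 0 < γ k) (hm : StrictMono γ)
  (ht : Tendsto γ atTop atTop) (hs : Summable fun k => c k / γ k)

/-- The weights of the remaining factor after a pair of conjugate zeros `w`, `conj w` has been
split off. -/
noncomputable def quotientWeight (c γ : ℕ → ℝ) (w : ℂ) (k : ℕ) : ℝ :=
  c k / Complex.normSq (w + (γ k : ℂ))

theorem quotientWeight_pos (hc : ∀ k, 0 < c k) {w : ℂ} (hw : w.im ≠ 0) (k : ℕ) :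
    0 < quotientWeight c γ w k :=
  div_pos (hc k) (Complex.normSq_pos.2 (add_ofReal_ne_zero hw _))

theorem summable_quotientWeight_div (hc : ∀ k, 0 < c k) (hγ : ∀ k, 0 < γ k)
    (hs : Summable fun k => c k / γ k) {w : ℂ} (hw : w.im ≠ 0) :
    Summable fun k => quotientWeight c γ w k / γ k := by
  refine Summable.of_nonneg_of_le
    (fun k => (div_pos (quotientWeight_pos hc hw k) (hγ k)).le) (fun k => ?_)
    (hs.mul_left (1 / w.im ^ 2))
  have h0 : 0 < w.im ^ 2 := by positivity
  have h1 : w.im ^ 2 ≤ Complex.normSq (w + (γ k : ℂ)) := by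
    rw [Complex.normSq_apply]
    simp
    nlinarith [sq_nonneg (w.re + γ k)]
  rw [quotientWeight, ← mul_div_assoc, one_div, ← div_eq_inv_mul]
  exact div_le_div_of_nonneg_right (div_le_div_of_nonneg_left (hc k).le h0 h1) (hγ k).le

include hc hγ ht hs in
-- Termwise this is the second divided difference of `s ↦ c_k / (s + γ_k)` at the nodes `z`, `w`,
-- `conj w`, which equals `c_k / ((z + γ_k) (w + γ_k) (conj w + γ_k))`.
theorem mul_Khat_quotientWeight {w z : ℂ} (hw : w.im ≠ 0) (hz : ∀ k, z ≠ -(γ k : ℂ)) :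
    (z - w) * (z - conj w) * Khat (quotientWeight c γ w) γ z =
      Khat c γ z + (z - conj w) / (conj w - w) * Khat c γ w
        + (z - w) / (w - conj w) * Khat c γ (conj w) := by
  have hne : w - conj w ≠ 0 := by
    intro h
    apply hw
    have := congrArg Complex.im h
    simp at this
    linarith
  have hne' : conj w - w ≠ 0 := fun h => hne (by rw [← neg_sub, h, neg_zero])
  have hd := summable_div (quotientWeight_pos hc hw) ht (summable_quotientWeight_div hc hγ hs hw) z
  have h1 := summable_div hc ht hs z
  have h2 := summable_div hc ht hs w
  have h3 := summable_div hc ht hs (conj w)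
  simp only [Khat]
  rw [← tsum_mul_left, ← tsum_mul_left, ← tsum_mul_left, ← h1.tsum_add (h2.mul_left _),
    ← (h1.add (h2.mul_left _)).tsum_add (h3.mul_left _)]
  refine tsum_congr fun k => ?_
  have e1 : z + (γ k : ℂ) ≠ 0 := fun h => hz k (eq_neg_of_add_eq_zero_left h)
  have e2 := add_ofReal_ne_zero hw (γ k)
  have e3 : conj w + (γ k : ℂ) ≠ 0 := add_ofReal_ne_zero (by simpa using hw) (γ k)
  have e4 : ((quotientWeight c γ w k : ℝ) : ℂ) = c k / ((w + γ k) * (conj w + γ k)) := by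
    rw [quotientWeight, Complex.ofReal_div, Complex.normSq_eq_conj_mul_self]
    simp [mul_comm]
  rw [e4]
  generalize conj w = v at *
  have e5 : v - w = -(w - v) := by ring
  rw [e5]
  field_simp
  ring

include hc hγ ht hs in
/-- Splitting off a pair of conjugate zeros. -/
theorem quadratic_sub_Khat_eq_mul {a b : ℝ} {w z : ℂ} (hw : w.im ≠ 0) (hz : ∀ k, z ≠ -(γ k : ℂ))
    (h : w ^ 2 + (a : ℂ) ^ 2 - b * Khat c γ w = 0) :
    z ^ 2 + (a : ℂ) ^ 2 - b * Khat c γ z =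
      (z - w) * (z - conj w) * (1 - b * Khat (quotientWeight c γ w) γ z) := by
  have hK := mul_Khat_quotientWeight hc hγ ht hs hw hz
  have h' : (conj w) ^ 2 + (a : ℂ) ^ 2 - b * Khat c γ (conj w) = 0 := by
    rw [Khat_conj]
    simpa using congrArg conj h
  have hne : w - conj w ≠ 0 := by
    intro h
    apply hw
    have := congrArg Complex.im h
    simp at this
    linarith
  have e5 : conj w - w = -(w - conj w) := by ring
  rw [e5] at hK
  generalize Khat c γ (conj w) = L' at *
  generalize conj w = v at *
  have : (z - w) * (z - v) * (1 - b * Khat (quotientWeight c γ w) γ z) =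
    (z - w) * (z - v) - b * ((z - w) * (z - v) * Khat (quotientWeight c γ w) γ z) := by ring
  rw [this, hK]
  field_simp
  -- The equations at `w` and `conj w` eliminate the two values of `Khat` there; the quadratic part
  -- contributes its divided difference, which is `1`.
  linear_combination (z - v) * h - (z - w) * h'

include hc hγ hm ht hs in
/-- The zeros of `fSym` and of `ell` interlace, as soon as `ell` has one non-real zero. -/
theorem exists_zeros_fSym_ell {a ξ : ℝ} (ha : 0 < a)
    (h1 : 1 / a ^ (2 * (1 - ξ)) * ∑' k, c k / γ k < 1) {w : ℂ} (hw : 0 < w.im)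
    (hz : ell a ξ c γ w = 0) :
    ∃ lam x : ℕ → ℝ,
      {t : ℝ | (t : ℂ) ∈ zerosOff γ (fSym a ξ c γ)} = Set.range x ∧
      zerosOff γ (ell a ξ c γ) = Set.range (fun k => (lam k : ℂ)) ∪ {w, conj w} ∧
      (∀ k, -γ k < lam k ∧ lam k < x k) ∧ (∀ k, x (k + 1) < -γ k) ∧ x 0 < 0 := by
  set s : ℝ := 1 / a ^ (2 * (1 - ξ)) with hs_def
  have hs0 : 0 < s := by positivity
  have hf : ∀ z, fSym a ξ c γ z = 1 - (s : ℂ) * Khat c γ z := fun z => by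
    simp [fSym, hs_def]
  have hell : ∀ z, ell a ξ c γ z = z ^ 2 + (a : ℂ) ^ 2 - ((a ^ 2 * s : ℝ) : ℂ) * Khat c γ z :=
    fun z => by
    rw [ell, hf]
    push_cast
    ring
  set b : ℝ := a ^ 2 * s with hb_def
  have hb : 0 < b := by positivity
  obtain ⟨x, hx0, hxI, hxneg, hxlt⟩ := exists_zeros_one_sub_Khat hc hγ hm ht hs hs0 h1
  have hfac : ∀ z, (∀ k, z ≠ -(γ k : ℂ)) → ell a ξ c γ z =
      (z - w) * (z - conj w) * (1 - b * Khat (quotientWeight c γ w) γ z) := fun z hzp => by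
    rw [hell]
    exact quadratic_sub_Khat_eq_mul hc hγ ht hs hw.ne' hzp (by rw [← hell, hz])
  have hd := quotientWeight_pos (γ := γ) hc hw.ne'
  have hds := summable_quotientWeight_div hc hγ hs hw.ne'
  -- The factorization at `z = 0` reads `a² (1 - s K(0)) = |w|² (1 - b K₁(0))`; the left side is
  -- positive.
  have hd1 : b * ∑' k, quotientWeight c γ w k / γ k < 1 := by
    have h0 := hfac 0 (fun k h => by
      have : γ k = 0 := by exact_mod_cast neg_eq_zero.1 h.symm
      linarith [hγ k])
    have hK : ∀ e : ℕ → ℝ, Khat e γ 0 = ((∑' k, e k / γ k : ℝ) : ℂ) := fun e => by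
      have := Khat_ofReal e γ 0
      simpa [realKhat] using this
    rw [hell, hK, hK, show (0 - w) * (0 - conj w) = (Complex.normSq w : ℂ) by
      rw [Complex.normSq_eq_conj_mul_self]; ring] at h0
    have h0' : a ^ 2 * (1 - s * ∑' k, c k / γ k) =
        Complex.normSq w * (1 - b * ∑' k, quotientWeight c γ w k / γ k) := by
      have : ((a ^ 2 * (1 - s * ∑' k, c k / γ k) : ℝ) : ℂ) =
        ((Complex.normSq w * (1 - b * ∑' k, quotientWeight c γ w k / γ k) : ℝ) : ℂ) := by
        simp only [Complex.ofReal_mul, Complex.ofReal_sub, Complex.ofReal_one]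
        rw [← h0, hb_def]
        push_cast
        ring
      exact_mod_cast this
    have hl : 0 < a ^ 2 * (1 - s * ∑' k, c k / γ k) := mul_pos (by positivity) (by linarith)
    rw [h0'] at hl
    have := (pos_iff_pos_of_mul_pos hl).1
      (Complex.normSq_pos.2 (fun h => by simp [h] at hw))
    linarith
  obtain ⟨l, hl0, hlI, -, -⟩ := exists_zeros_one_sub_Khat hd hγ hm ht hds hb hd1
  refine ⟨l, x, ?_, ?_, fun k => ⟨(hlI k).1, ?_⟩, fun k => (hxI (k + 1)).2 k (Nat.lt_succ_self k),
    hxneg⟩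
  · ext t
    rw [Set.mem_ofPred_eq, show fSym a ξ c γ = _ from funext hf, hx0]
    simp
  · ext z
    constructor
    · rintro ⟨hzp, hz0⟩
      rw [hfac z hzp] at hz0
      rcases mul_eq_zero.1 hz0 with h | h
      · right
        rcases mul_eq_zero.1 h with h | h
        · exact Or.inl (sub_eq_zero.1 h)
        · exact Or.inr (sub_eq_zero.1 h)
      · left
        rw [← hl0]
        exact ⟨hzp, h⟩
    · rintro (h | rfl | h)
      · rw [← hl0] at h
        refine ⟨h.1, ?_⟩
        rw [hfac z h.1, show 1 - (b : ℂ) * _ = 0 from h.2, mul_zero]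
      · exact ⟨fun k => ne_neg_ofReal_of_im_ne_zero hw.ne' _, hz⟩
      · have h : z = conj w := h
        have hzp : ∀ k, z ≠ -(γ k : ℂ) := fun k =>
          ne_neg_ofReal_of_im_ne_zero (by simpa [h] using hw.ne') _
        refine ⟨hzp, ?_⟩
        rw [hfac z hzp, h, sub_self, mul_zero, zero_mul]
  -- Since `ell` vanishes at `l k`, `a² f(l k) = -(l k)²`. This is negative once `l k ≠ 0`, so `l k`
  -- lies to the left of `x k`.
  · refine hxlt k _ (hlI k) ?_
    have hmem : ((l k : ℝ) : ℂ) ∈ zerosOff γ fun z => 1 - (b : ℂ) *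
        Khat (quotientWeight c γ w) γ z := by
      rw [hl0]
      exact ⟨k, rfl⟩
    have h2 : ell a ξ c γ (l k) = 0 := by
      rw [hfac _ hmem.1, show 1 - (b : ℂ) * _ = 0 from hmem.2, mul_zero]
    rw [hell, Khat_ofReal] at h2
    have h3 : l k ^ 2 + a ^ 2 * (1 - s * realKhat c γ (l k)) = 0 := by
      have : l k ^ 2 + a ^ 2 - b * realKhat c γ (l k) = 0 := by exact_mod_cast h2
      rw [← this, hb_def]
      ring
    -- On `[0, ∞)` the real `Khat` is at most its value at `0`, so `f > 0` and `ell` cannot vanish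
    -- there.
    have h4 : l k < 0 := by
      by_contra! h
      have hK : s * realKhat c γ (l k) < 1 := by
        have h0 : (0 : ℝ) ∈ poleInterval γ 0 := ⟨by linarith [hγ 0], by simp⟩
        have hk : l k ∈ poleInterval γ 0 := ⟨by linarith [hγ 0], by simp⟩
        have := (realKhat_strictAntiOn hc hm ht hs 0).antitoneOn h0 hk h
        rw [show realKhat c γ 0 = ∑' k, c k / γ k by simp [realKhat]] at this
        exact (mul_le_mul_of_nonneg_left this hs0.le).trans_lt h1
      have : 0 < a ^ 2 * (1 - s * realKhat c γ (l k)) := mul_pos (by positivity) (by linarith)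
      nlinarith [sq_nonneg (l k)]
    have h5 : 0 < l k ^ 2 := by nlinarith
    by_contra! h
    nlinarith [mul_nonneg (sq_nonneg a) h]

end Factor

/-! ### A non-real zero near `ia` by contraction. -/

section FixedPoint

variable {c γ : ℕ → ℝ} (hc : ∀ k, 0 < c k) (hγ : ∀ k, 0 < γ k)
  (ht : Tendsto γ atTop atTop) (hs : Summable fun k => c k / γ k)

theorem summable_div_max (hc : ∀ k, 0 < c k) (hγ : ∀ k, 0 < γ k)
    (hs : Summable fun k => c k / γ k) (a : ℝ) : Summable fun k => c k / max a (γ k) :=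
  Summable.of_nonneg_of_le
    (fun k => div_nonneg (hc k).le ((hγ k).le.trans (le_max_right _ _)))
    (fun k => div_le_div_of_nonneg_left (hc k).le (hγ k) (le_max_right _ _)) hs

/-- At `z = ia` the norm dominates both `a` and `g`; moving by at most `a / 4` loses less than half.
This makes `∑ c_k / max a γ_k` control `Khat` and its Lipschitz constant on the whole disc. -/
theorem max_le_two_mul_norm {a g : ℝ} (ha : 0 < a) {z : ℂ}
    (hz : ‖z - Complex.I * a‖ ≤ a / 4) : max a g ≤ 2 * ‖z + (g : ℂ)‖ := by
  have h1 : max a g ≤ ‖Complex.I * a + (g : ℂ)‖ := by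
    refine max_le ?_ ?_
    · have := Complex.abs_im_le_norm (Complex.I * a + (g : ℂ))
      simp only [Complex.add_im, Complex.mul_im, Complex.I_re, Complex.I_im, Complex.ofReal_im,
        Complex.ofReal_re] at this
      exact (by simpa using le_abs_self a : a ≤ _).trans this
    · have := Complex.abs_re_le_norm (Complex.I * a + (g : ℂ))
      simp only [Complex.add_re, Complex.mul_re, Complex.I_re, Complex.I_im, Complex.ofReal_im,
        Complex.ofReal_re] at this
      exact (by simpa using le_abs_self g : g ≤ _).trans this
  have h2 : ‖Complex.I * a + (g : ℂ)‖ ≤ ‖z + (g : ℂ)‖ + ‖z - Complex.I * a‖ := by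
    have := norm_sub_le (z + (g : ℂ)) (z - Complex.I * a)
    rwa [show z + (g : ℂ) - (z - Complex.I * a) = Complex.I * a + (g : ℂ) by ring] at this
  linarith [le_max_left a g]

include hc hγ hs in
theorem norm_Khat_le {a : ℝ} (ha : 0 < a) {z : ℂ} (hz : ‖z - Complex.I * a‖ ≤ a / 4) :
    ‖Khat c γ z‖ ≤ 2 * ∑' k, c k / max a (γ k) := by
  rw [← tsum_mul_left]
  refine tsum_of_norm_bounded ((summable_div_max hc hγ hs a).mul_left 2).hasSum fun k => ?_
  have h0 : 0 < max a (γ k) := lt_max_of_lt_left ha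
  have h1 := max_le_two_mul_norm (g := γ k) ha hz
  rw [norm_div, Complex.norm_real, Real.norm_of_nonneg (hc k).le, ← mul_div_assoc,
    div_le_div_iff₀ (by linarith) h0]
  nlinarith [hc k]

include hc hγ ht hs in
theorem norm_Khat_sub_le {a : ℝ} (ha : 0 < a) {z w : ℂ} (hz : ‖z - Complex.I * a‖ ≤ a / 4)
    (hw : ‖w - Complex.I * a‖ ≤ a / 4) :
    ‖Khat c γ z - Khat c γ w‖ ≤ 4 / a * (∑' k, c k / max a (γ k)) * ‖z - w‖ := by
  have hsum := summable_div_max hc hγ hs a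
  rw [Khat, Khat, ← (summable_div hc ht hs z).tsum_sub (summable_div hc ht hs w),
    show 4 / a * (∑' k, c k / max a (γ k)) * ‖z - w‖ =
      (4 / a * ‖z - w‖) * ∑' k, c k / max a (γ k) by ring, ← tsum_mul_left]
  refine tsum_of_norm_bounded (hsum.mul_left _).hasSum fun k => ?_
  have h0 : 0 < max a (γ k) := lt_max_of_lt_left ha
  have h1 := max_le_two_mul_norm (g := γ k) ha hz
  have h2 := max_le_two_mul_norm (g := γ k) ha hw
  have h1' : 0 < ‖z + (γ k : ℂ)‖ := by linarith
  have h2' : 0 < ‖w + (γ k : ℂ)‖ := by linarith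
  have e : (c k : ℂ) / (z + γ k) - c k / (w + γ k) =
      c k * (w - z) / ((z + γ k) * (w + γ k)) := by
    rw [div_sub_div _ _ (norm_pos_iff.1 h1') (norm_pos_iff.1 h2')]
    ring
  rw [e, norm_div, norm_mul, norm_mul, Complex.norm_real, Real.norm_of_nonneg (hc k).le,
    norm_sub_rev w z]
  have h3 : a * max a (γ k) ≤ 4 * (‖z + (γ k : ℂ)‖ * ‖w + (γ k : ℂ)‖) := by
    nlinarith [le_max_left a (γ k)]
  have h4 : c k * ‖z - w‖ / (‖z + (γ k : ℂ)‖ * ‖w + (γ k : ℂ)‖) ≤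
      4 * (c k * ‖z - w‖) / (a * max a (γ k)) := by
    rw [div_le_div_iff₀ (by positivity) (by positivity)]
    have := mul_le_mul_of_nonneg_left h3 (mul_nonneg (hc k).le (norm_nonneg (z - w)))
    linarith
  refine h4.trans_eq ?_
  field_simp

include hc hγ ht hs in
-- The real part and minus the imaginary part of each term at `ia` are positive, and their sum `c (a
-- + γ) / (a² + γ²)` is at least `c / max a γ`. Without cancellation, `Khat (ia)` alone bounds the
-- majorant, so the smallness condition and the final error can be stated through it.
theorem tsum_div_max_le {a : ℝ} (ha : 0 < a) :
    ∑' k, c k / max a (γ k) ≤ 2 * ‖Khat c γ (Complex.I * a)‖ := by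
  have hsum := summable_div_max hc hγ hs a
  have hK := (summable_div hc ht hs (Complex.I * a)).hasSum
  have hre := Complex.hasSum_re hK
  have him := Complex.hasSum_im hK
  have h1 : ∑' k, c k / max a (γ k) ≤ (Khat c γ (Complex.I * a)).re -
      (Khat c γ (Complex.I * a)).im := by
    refine hasSum_le (fun k => ?_) hsum.hasSum (hre.sub him)
    have h0 : 0 < max a (γ k) := lt_max_of_lt_left ha
    have hN : Complex.normSq (Complex.I * a + γ k) = a ^ 2 + γ k ^ 2 := by
      rw [Complex.normSq_apply]
      simp
      ring
    have e : ((c k : ℂ) / (Complex.I * a + γ k)).re - ((c k : ℂ) / (Complex.I * a + γ k)).im =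
        c k * (a + γ k) / (a ^ 2 + γ k ^ 2) := by
      rw [Complex.div_re, Complex.div_im, hN]
      simp
      ring
    have hp : 0 < a ^ 2 + γ k ^ 2 := by positivity
    rw [e, div_le_div_iff₀ h0 hp, mul_assoc]
    refine mul_le_mul_of_nonneg_left ?_ (hc k).le
    nlinarith [le_max_left a (γ k), le_max_right a (γ k), hγ k]
  have h2 := (le_abs_self _).trans (Complex.abs_re_le_norm (Khat c γ (Complex.I * a)))
  have h3 := (neg_le_abs _).trans (Complex.abs_im_le_norm (Khat c γ (Complex.I * a)))
  linarith

include hc hγ ht hs in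
/-- If the sum is small compared with `a ^ 2`, then there is a zero near `I * a`. -/
theorem exists_zero_near_I_mul {a b : ℝ} (ha : 0 < a) (hb : 0 < b)
    (hsmall : b * ‖Khat c γ (Complex.I * a)‖ ≤ a ^ 2 / 64) :
    ∃ w : ℂ, 0 < w.im ∧ w ^ 2 + (a : ℂ) ^ 2 - b * Khat c γ w = 0 ∧
      ‖w - (Complex.I * a + b * Khat c γ (Complex.I * a) / (2 * Complex.I * a))‖ ≤
        24 * b ^ 2 * ‖Khat c γ (Complex.I * a)‖ ^ 2 / a ^ 3 := by
  set M := ∑' k, c k / max a (γ k) with hM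
  have hM0 : 0 ≤ M := tsum_nonneg fun k => div_nonneg (hc k).le (ha.le.trans (le_max_left _ _))
  have hMK : M ≤ 2 * ‖Khat c γ (Complex.I * a)‖ := tsum_div_max_le hc hγ ht hs ha
  have hbM : b * M ≤ a ^ 2 / 32 := by nlinarith
  have haC : (a : ℂ) ≠ 0 := by exact_mod_cast ha.ne'
  have hn2 : ‖2 * Complex.I * (a : ℂ)‖ = 2 * a := by simp [abs_of_pos ha]
  -- Since `(ia + δ)² + a² = 2iaδ + δ²`, fixed points of `T` are exactly the zeros `ia + δ`.
  set T : ℂ → ℂ := fun δ =>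
    (b * Khat c γ (Complex.I * a + δ) - δ ^ 2) / (2 * Complex.I * a) with hT
  have hnb : ‖(b : ℂ)‖ = b := by rw [Complex.norm_real, Real.norm_of_nonneg hb.le]
  have hshift : ∀ δ : ℂ, ‖δ‖ ≤ a / 4 → ‖Complex.I * a + δ - Complex.I * a‖ ≤ a / 4 := fun δ h => by
    rwa [add_sub_cancel_left]
  have hTle : ∀ δ : ℂ, ‖δ‖ ≤ a / 4 → ‖T δ‖ ≤ (2 * (b * M) + a / 4 * ‖δ‖) / (2 * a) := by
    intro δ hδ
    rw [hT, norm_div, hn2]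
    refine div_le_div_of_nonneg_right ((norm_sub_le _ _).trans (add_le_add ?_ ?_)) (by linarith)
    · rw [norm_mul, hnb]
      nlinarith [norm_Khat_le hc hγ hs ha (hshift δ hδ)]
    · rw [norm_pow, sq]
      exact mul_le_mul_of_nonneg_right hδ (norm_nonneg _)
  have hmaps : Set.MapsTo T (Metric.closedBall 0 (a / 4)) (Metric.closedBall 0 (a / 4)) := by
    intro δ hδ
    rw [mem_closedBall_zero_iff] at hδ ⊢
    refine (hTle δ hδ).trans ?_
    rw [div_le_iff₀ (by linarith)]
    nlinarith
  have hcontr : ContractingWith (1 / 2) (hmaps.restrict T _ _) := by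
    refine ⟨by rw [← NNReal.coe_lt_coe]; push_cast; norm_num,
      LipschitzWith.of_dist_le_mul fun x y => ?_⟩
    obtain ⟨x, hx⟩ := x
    obtain ⟨y, hy⟩ := y
    rw [mem_closedBall_zero_iff] at hx hy
    rw [Subtype.dist_eq, Subtype.dist_eq]
    simp only [Set.MapsTo.val_restrict_apply, dist_eq_norm, hT]
    rw [← sub_div, norm_div, hn2, div_le_iff₀ (by linarith),
      show (b * Khat c γ (Complex.I * a + x) - x ^ 2) - (b * Khat c γ (Complex.I * a + y) - y ^ 2)
        = b * (Khat c γ (Complex.I * a + x) - Khat c γ (Complex.I * a + y))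
          - (x + y) * (x - y) by ring]
    refine (norm_sub_le _ _).trans ?_
    rw [norm_mul, norm_mul, hnb]
    have h1 := norm_Khat_sub_le hc hγ ht hs ha (hshift x hx) (hshift y hy)
    rw [add_sub_add_left_eq_sub] at h1
    have h2 : ‖x + y‖ ≤ a / 2 := (norm_add_le _ _).trans (by linarith)
    -- The Lipschitz constant of `T` is at most `(a/8 + a/2) / (2a) < 1/2`.
    have h3 : 4 / a * (b * M) ≤ a / 8 := by
      rw [div_mul_eq_mul_div, div_le_iff₀ ha]
      nlinarith
    have h4 := mul_le_mul_of_nonneg_left h1 hb.le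
    have h5 := mul_le_mul_of_nonneg_right h2 (norm_nonneg (x - y))
    have h6 := mul_le_mul_of_nonneg_right h3 (norm_nonneg (x - y))
    have h7 : 0 ≤ a * ‖x - y‖ := by positivity
    push_cast
    nlinarith
  obtain ⟨δ, hδ, hfix, -⟩ := ContractingWith.exists_fixedPoint' Metric.isClosed_closedBall.isComplete
    hmaps hcontr (Metric.mem_closedBall_self (by linarith)) (edist_ne_top _ _)
  rw [mem_closedBall_zero_iff] at hδ
  have hfix' : δ * (2 * Complex.I * a) = b * Khat c γ (Complex.I * a + δ) - δ ^ 2 := by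
    have h : T δ = δ := hfix
    rw [hT] at h
    rwa [eq_comm, eq_div_iff (by simp [haC])] at h
  -- The ball bound `‖δ‖ ≤ a / 4` allows the quadratic term to be absorbed into the left side, which
  -- improves the estimate to the true size of `δ`.
  have hδle : ‖δ‖ ≤ 2 * (b * M) / a := by
    have h := hTle δ hδ
    rw [show T δ = δ from hfix, le_div_iff₀ (by linarith)] at h
    rw [le_div_iff₀ ha]
    nlinarith [norm_nonneg δ]
  refine ⟨Complex.I * a + δ, ?_, ?_, ?_⟩
  · have := (neg_le_abs _).trans ((Complex.abs_im_le_norm δ).trans hδ)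
    simp
    linarith
  · have hI := Complex.I_sq
    linear_combination hfix' + (a : ℂ) ^ 2 * hI
  · have e : Complex.I * a + δ -
        (Complex.I * a + b * Khat c γ (Complex.I * a) / (2 * Complex.I * a)) =
        (b * (Khat c γ (Complex.I * a + δ) - Khat c γ (Complex.I * a)) - δ ^ 2)
          / (2 * Complex.I * a) := by
      have hδe : δ = (b * Khat c γ (Complex.I * a + δ) - δ ^ 2) / (2 * Complex.I * a) := by
        rw [eq_div_iff (by simp [haC]), hfix']
      rw [add_sub_add_left_eq_sub]
      nth_rewrite 1 [hδe]
      ring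
    rw [e, norm_div, hn2]
    have h1 := norm_Khat_sub_le hc hγ ht hs ha (hshift δ hδ)
      (by rw [sub_self, norm_zero]; positivity : ‖Complex.I * (a : ℂ) - Complex.I * a‖ ≤ a / 4)
    rw [add_sub_cancel_left] at h1
    have h2 : ‖(b : ℂ) * (Khat c γ (Complex.I * a + δ) - Khat c γ (Complex.I * a)) - δ ^ 2‖ ≤
        b * (4 / a * M * ‖δ‖) + ‖δ‖ ^ 2 := by
      refine (norm_sub_le _ _).trans ?_
      rw [norm_mul, hnb, norm_pow]
      gcongr
    have h3 : b * (4 / a * M * ‖δ‖) + ‖δ‖ ^ 2 ≤ 12 * (b * M) ^ 2 / a ^ 2 := by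
      calc _ ≤ b * (4 / a * M * (2 * (b * M) / a)) + (2 * (b * M) / a) ^ 2 := by gcongr
        _ = _ := by field_simp; ring
    calc _ ≤ (12 * (b * M) ^ 2 / a ^ 2) / (2 * a) := by gcongr; exact h2.trans h3
      _ = 6 * b ^ 2 * M ^ 2 / a ^ 3 := by field_simp; ring
      _ ≤ 6 * b ^ 2 * (2 * ‖Khat c γ (Complex.I * a)‖) ^ 2 / a ^ 3 := by gcongr
      _ = _ := by ring

end FixedPoint

/-! ### Replacing the sum on the imaginary axis by an integral. -/

open MeasureTheory

/-- The function `x ↦ x ^ (-α) / (i a + B x ^ β)`. -/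
noncomputable def modelTerm (α β B a : ℝ) (x : ℝ) : ℂ :=
  ((x ^ (-α) : ℝ) : ℂ) / (Complex.I * a + ((B * x ^ β : ℝ) : ℂ))

theorem le_norm_I_mul_add_left (a g : ℝ) : a ≤ ‖Complex.I * a + (g : ℂ)‖ := by
  have := (le_abs_self _).trans (Complex.abs_im_le_norm (Complex.I * a + (g : ℂ)))
  simpa using this

theorem le_norm_I_mul_add_right (a g : ℝ) : g ≤ ‖Complex.I * a + (g : ℂ)‖ := by
  have := (le_abs_self _).trans (Complex.abs_re_le_norm (Complex.I * a + (g : ℂ)))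
  simpa using this

theorem I_mul_add_ne_zero {a : ℝ} (ha : 0 < a) (g : ℝ) : Complex.I * a + (g : ℂ) ≠ 0 :=
  norm_pos_iff.1 (ha.trans_le (le_norm_I_mul_add_left a g))

theorem norm_modelTerm_le {α β B a x : ℝ} (ha : 0 < a) (hx : 0 < x) :
    ‖modelTerm α β B a x‖ ≤ x ^ (-α) / a := by
  have h := Real.rpow_pos_of_pos hx (-α)
  rw [modelTerm, norm_div, Complex.norm_real, Real.norm_of_nonneg h.le]
  exact div_le_div_of_nonneg_left h.le ha (le_norm_I_mul_add_left _ _)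

theorem norm_modelTerm_le' {α β B a x : ℝ} (hB : 0 < B) (hx : 0 < x) :
    ‖modelTerm α β B a x‖ ≤ x ^ (-(α + β)) / B := by
  have h := Real.rpow_pos_of_pos hx (-α)
  have h' := Real.rpow_pos_of_pos hx β
  rw [modelTerm, norm_div, Complex.norm_real, Real.norm_of_nonneg h.le]
  refine (div_le_div_of_nonneg_left h.le (by positivity) (le_norm_I_mul_add_right _ _)).trans_eq ?_
  rw [neg_add, ← sub_eq_add_neg, Real.rpow_sub hx]
  field_simp

theorem hasDerivAt_modelTerm {α β B a x : ℝ} (ha : 0 < a) (hx : 0 < x) :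
    HasDerivAt (modelTerm α β B a)
      ((((-α * x ^ (-α - 1) : ℝ) : ℂ) * (Complex.I * a + ((B * x ^ β : ℝ) : ℂ))
        - ((x ^ (-α) : ℝ) : ℂ) * ((B * (β * x ^ (β - 1)) : ℝ) : ℂ)) /
        (Complex.I * a + ((B * x ^ β : ℝ) : ℂ)) ^ 2) x := by
  have h1 := (Real.hasDerivAt_rpow_const (p := -α) (Or.inl hx.ne')).ofReal_comp
  have h2 := (((Real.hasDerivAt_rpow_const (p := β) (Or.inl hx.ne')).const_mul B).ofReal_comp).const_add
    (Complex.I * a)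
  exact h1.fun_div h2 (I_mul_add_ne_zero ha _)

/-- Differentiating either factor costs `1/x`, because `B x^β` is bounded by the denominator; the
remaining denominator is at least `a`. Thus the variation over unit intervals is summable, with
total `O(1/a)`. -/
theorem norm_deriv_modelTerm_le {α β B a x : ℝ} (hα : 0 < α) (hβ : 0 < β) (hB : 0 < B)
    (ha : 0 < a) (hx : 0 < x) :
    ‖(((-α * x ^ (-α - 1) : ℝ) : ℂ) * (Complex.I * a + ((B * x ^ β : ℝ) : ℂ))
        - ((x ^ (-α) : ℝ) : ℂ) * ((B * (β * x ^ (β - 1)) : ℝ) : ℂ)) /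
        (Complex.I * a + ((B * x ^ β : ℝ) : ℂ)) ^ 2‖ ≤ (α + β) / a * x ^ (-α - 1) := by
  set D := Complex.I * a + ((B * x ^ β : ℝ) : ℂ) with hD
  have hx1 := Real.rpow_pos_of_pos hx (-α - 1)
  have hx2 := Real.rpow_pos_of_pos hx (-α)
  have hx3 := Real.rpow_pos_of_pos hx (β - 1)
  have hx4 := Real.rpow_pos_of_pos hx β
  have h1 : a ≤ ‖D‖ := le_norm_I_mul_add_left a _
  have h2 : B * x ^ β ≤ ‖D‖ := le_norm_I_mul_add_right a _
  have hD0 : 0 < ‖D‖ := ha.trans_le h1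
  have e : x ^ (-α) * (B * (β * x ^ (β - 1))) = β * x ^ (-α - 1) * (B * x ^ β) := by
    have : x ^ (-α) * x ^ (β - 1) = x ^ (-α - 1) * x ^ β := by
      rw [← Real.rpow_add hx, ← Real.rpow_add hx]; ring_nf
    linear_combination B * β * this
  rw [norm_div, norm_pow, div_le_iff₀ (by positivity)]
  refine (norm_sub_le _ _).trans ?_
  rw [← Complex.ofReal_mul, e, norm_mul, Complex.norm_real, Complex.norm_real,
    Real.norm_of_nonneg (by positivity : 0 ≤ β * x ^ (-α - 1) * (B * x ^ β)), norm_mul, norm_neg,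
    Real.norm_of_nonneg hα.le, Real.norm_of_nonneg hx1.le]
  have h3 : α * x ^ (-α - 1) * ‖D‖ + β * x ^ (-α - 1) * (B * x ^ β) ≤
      (α + β) * x ^ (-α - 1) * ‖D‖ := by
    have := mul_le_mul_of_nonneg_left h2 (by positivity : 0 ≤ β * x ^ (-α - 1))
    linarith
  refine h3.trans ?_
  calc (α + β) * x ^ (-α - 1) * ‖D‖ = (α + β) / a * x ^ (-α - 1) * (a * ‖D‖) := by field_simp
    _ ≤ (α + β) / a * x ^ (-α - 1) * (‖D‖ * ‖D‖) := by gcongr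
    _ = _ := by ring

theorem continuousOn_modelTerm {α β B a : ℝ} (ha : 0 < a) :
    ContinuousOn (modelTerm α β B a) (Set.Ioi 0) := fun _ hx =>
  (hasDerivAt_modelTerm ha hx).continuousAt.continuousWithinAt

theorem integrableOn_modelTerm {α β B a : ℝ} (hB : 0 < B) (ha : 0 < a) (hαβ : 1 < α + β) :
    IntegrableOn (modelTerm α β B a) (Set.Ioi 1) := by
  have h := (integrableOn_Ioi_rpow_of_lt (by linarith : -(α + β) < -1) one_pos).div_const B
  refine h.mono' (((continuousOn_modelTerm ha).mono
    (Set.Ioi_subset_Ioi zero_le_one)).aestronglyMeasurable measurableSet_Ioi) ?_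
  filter_upwards [ae_restrict_mem measurableSet_Ioi] with x hx
  exact norm_modelTerm_le' hB (zero_lt_one.trans hx)

theorem hasSum_integral_Ioc_add_one {f : ℝ → ℂ} (hf : IntegrableOn f (Set.Ioi 1)) :
    HasSum (fun k : ℕ => ∫ x in Set.Ioc ((k : ℝ) + 1) ((k : ℝ) + 1 + 1), f x)
      (∫ x in Set.Ioi 1, f x) := by
  have hU : ⋃ k : ℕ, Set.Ioc ((k : ℝ) + 1) ((k : ℝ) + 1 + 1) = Set.Ioi 1 := by
    ext x
    simp only [Set.mem_iUnion, Set.mem_Ioc, Set.mem_Ioi]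
    constructor
    · rintro ⟨k, hk, -⟩
      have : (0 : ℝ) ≤ k := k.cast_nonneg
      linarith
    · intro hx
      -- The intervals are `(k + 1, k + 2]`, so `k = ⌈x⌉ - 2`; the natural subtraction is exact
      -- because `x > 1`.
      refine ⟨⌈x⌉₊ - 2, ?_⟩
      have h2 : 2 ≤ ⌈x⌉₊ := Nat.lt_ceil.2 (by exact_mod_cast hx)
      have h3 := Nat.ceil_lt_add_one (zero_le_one.trans hx.le)
      have h4 := Nat.le_ceil x
      push_cast [Nat.cast_sub h2]
      constructor <;> linarith
  have hd : Pairwise (Function.onFun Disjoint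
      fun k : ℕ => Set.Ioc ((k : ℝ) + 1) ((k : ℝ) + 1 + 1)) := by
    have hmono : Monotone fun k : ℕ => (k : ℝ) + 1 := fun i j h => by
      have : (i : ℝ) ≤ j := by exact_mod_cast h
      simpa using this
    have := hmono.pairwise_disjoint_on_Ioc_succ
    simpa using this
  have := hasSum_integral_iUnion (μ := volume) (f := f)
    (s := fun k : ℕ => Set.Ioc ((k : ℝ) + 1) ((k : ℝ) + 1 + 1))
    (fun _ => measurableSet_Ioc) hd (by rwa [hU])
  rwa [hU] at this

theorem summable_add_one_rpow {p : ℝ} (hp : p < -1) :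
    Summable fun k : ℕ => ((k : ℝ) + 1) ^ p := by
  have := (summable_nat_add_iff 1).2 (Real.summable_nat_rpow.2 hp)
  simpa using this

theorem summable_modelTerm {α β B a : ℝ} (hB : 0 < B) (hαβ : 1 < α + β) :
    Summable fun k : ℕ => modelTerm α β B a ((k : ℝ) + 1) :=
  Summable.of_norm_bounded ((summable_add_one_rpow (by linarith : -(α + β) < -1)).div_const B)
    fun k => norm_modelTerm_le' hB (by positivity)

/-- Comparison of the sum of the model terms with the integral. -/
theorem norm_tsum_modelTerm_sub_integral_le {α β B a : ℝ} (hα : 0 < α) (hβ : 0 < β) (hB : 0 < B)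
    (hαβ : 1 < α + β) (ha : 0 < a) :
    ‖(∑' k : ℕ, modelTerm α β B a ((k : ℝ) + 1)) - ∫ x in Set.Ioi 1, modelTerm α β B a x‖ ≤
      (α + β) * (∑' k : ℕ, ((k : ℝ) + 1) ^ (-α - 1)) / a := by
  have hsum := (summable_modelTerm (α := α) (β := β) (a := a) hB hαβ).hasSum.sub
    (hasSum_integral_Ioc_add_one (integrableOn_modelTerm hB ha hαβ))
  rw [← hsum.tsum_eq, mul_div_right_comm, ← tsum_mul_left]
  refine tsum_of_norm_bounded
    ((summable_add_one_rpow (by linarith : -α - 1 < -1)).mul_left ((α + β) / a)).hasSum fun k => ?_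
  have hk : (0 : ℝ) < (k : ℝ) + 1 := by positivity
  have hint : IntervalIntegrable (modelTerm α β B a) volume ((k : ℝ) + 1) ((k : ℝ) + 1 + 1) := by
    refine ContinuousOn.intervalIntegrable_of_Icc (by linarith) ((continuousOn_modelTerm ha).mono ?_)
    exact fun x hx => hk.trans_le hx.1
  rw [← intervalIntegral.integral_of_le (by linarith)]
  have e : modelTerm α β B a ((k : ℝ) + 1) - ∫ x in ((k : ℝ) + 1)..((k : ℝ) + 1 + 1),
      modelTerm α β B a x = ∫ x in ((k : ℝ) + 1)..((k : ℝ) + 1 + 1),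
      (modelTerm α β B a ((k : ℝ) + 1) - modelTerm α β B a x) := by
    rw [intervalIntegral.integral_sub intervalIntegrable_const hint]
    simp
  rw [e]
  refine (intervalIntegral.norm_integral_le_of_norm_le_const
    (C := (α + β) / a * ((k : ℝ) + 1) ^ (-α - 1)) fun x hx => ?_).trans_eq (by simp)
  rw [Set.uIoc_of_le (by linarith)] at hx
  have hmv := (convex_Icc ((k : ℝ) + 1) ((k : ℝ) + 1 + 1)).norm_image_sub_le_of_norm_hasDerivWithin_le
    (fun y hy => (hasDerivAt_modelTerm (α := α) (β := β) (B := B) ha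
      (hk.trans_le hy.1)).hasDerivWithinAt)
    (C := (α + β) / a * ((k : ℝ) + 1) ^ (-α - 1))
    (fun y hy => (norm_deriv_modelTerm_le hα hβ hB ha (hk.trans_le hy.1)).trans ?_)
    (Set.left_mem_Icc.2 (by linarith)) ⟨hx.1.le, hx.2⟩
  · rw [norm_sub_rev]
    refine hmv.trans (mul_le_of_le_one_right (by positivity) ?_)
    rw [Real.norm_eq_abs, abs_le]
    constructor <;> linarith [hx.1, hx.2]
  · gcongr ?_ * ?_
    exact Real.rpow_le_rpow_of_nonpos hk hy.1 (by linarith)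

/-- Replacing the coefficients and the nodes by their leading terms costs `O (1 / a)`. -/
theorem exists_norm_Khat_sub_tsum_modelTerm_le {A B α β : ℝ} (hA : 0 < A) (hB : 0 < B)
    (hα : 0 < α) (hαβ : 1 < α + β) {c γ : ℕ → ℝ} (hc : ∀ k, 0 < c k)
    (ht : Tendsto γ atTop atTop) (hs : Summable fun k => c k / γ k)
    (hcO : (fun k : ℕ => c k - A * ((k : ℝ) + 1) ^ (-α)) =O[atTop]
      fun k : ℕ => ((k : ℝ) + 1) ^ (-α - 1))
    (hγO : (fun k : ℕ => γ k - B * ((k : ℝ) + 1) ^ β) =O[atTop]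
      fun k : ℕ => ((k : ℝ) + 1) ^ (β - 1)) :
    ∃ C, ∀ a : ℝ, 0 < a → ‖Khat c γ (Complex.I * a)
      - A * ∑' k : ℕ, modelTerm α β B a ((k : ℝ) + 1)‖ ≤ C / a := by
  obtain ⟨C₁, hC₁, h₁⟩ := bound_of_isBigO_nat_atTop hcO
  obtain ⟨C₂, hC₂, h₂⟩ := bound_of_isBigO_nat_atTop hγO
  refine ⟨(C₁ + A * C₂ / B) * ∑' k : ℕ, ((k : ℝ) + 1) ^ (-α - 1), fun a ha => ?_⟩
  have hsum := (summable_div hc ht hs (Complex.I * a)).hasSum.sub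
    ((summable_modelTerm (α := α) (β := β) (a := a) hB hαβ).hasSum.mul_left (A : ℂ))
  rw [Khat, ← hsum.tsum_eq, mul_div_right_comm, ← tsum_mul_left]
  refine tsum_of_norm_bounded
    ((summable_add_one_rpow (by linarith : -α - 1 < -1)).mul_left _).hasSum fun k => ?_
  have hk : (0 : ℝ) < (k : ℝ) + 1 := by positivity
  have k1 := Real.rpow_pos_of_pos hk (-α - 1)
  have k2 := Real.rpow_pos_of_pos hk (-α)
  have k3 := Real.rpow_pos_of_pos hk (β - 1)
  have k4 := Real.rpow_pos_of_pos hk β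
  have b1 := h₁ (x := k) k1.ne'
  have b2 := h₂ (x := k) k3.ne'
  rw [Real.norm_of_nonneg k1.le] at b1
  rw [Real.norm_of_nonneg k3.le] at b2
  set y : ℝ := (k : ℝ) + 1
  have n1 := I_mul_add_ne_zero ha (γ k)
  have n2 := I_mul_add_ne_zero ha (B * y ^ β)
  -- The error splits into one from the coefficient and one from the node. In the second, one
  -- denominator is bounded below by `a` and the other by `B y^β`, so both are `O(y^(-α-1) / a)`.
  have e : (c k : ℂ) / (Complex.I * a + γ k) - A * modelTerm α β B a y =
      ((c k - A * y ^ (-α) : ℝ) : ℂ) / (Complex.I * a + γ k)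
      - ((A * y ^ (-α) * (γ k - B * y ^ β) : ℝ) : ℂ) /
        ((Complex.I * a + γ k) * (Complex.I * a + (B * y ^ β : ℝ))) := by
    rw [modelTerm]
    field_simp
    push_cast
    ring
  rw [e]
  refine (norm_sub_le _ _).trans ?_
  rw [norm_div, norm_div, norm_mul, Complex.norm_real, Complex.norm_real, norm_mul,
    Real.norm_of_nonneg (by positivity : 0 ≤ A * y ^ (-α))]
  have l1 := le_norm_I_mul_add_left a (γ k)
  have l2 := le_norm_I_mul_add_right a (B * y ^ β)
  have q1 : ‖c k - A * y ^ (-α)‖ / ‖Complex.I * a + (γ k : ℂ)‖ ≤ C₁ * y ^ (-α - 1) / a :=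
    div_le_div₀ (by positivity) b1 ha l1
  have q2 : A * y ^ (-α) * ‖γ k - B * y ^ β‖ / (‖Complex.I * a + (γ k : ℂ)‖ *
      ‖Complex.I * a + ((B * y ^ β : ℝ) : ℂ)‖) ≤
      A * y ^ (-α) * (C₂ * y ^ (β - 1)) / (a * (B * y ^ β)) :=
    div_le_div₀ (by positivity) (by gcongr) (by positivity)
      (mul_le_mul l1 l2 (by positivity) (norm_nonneg _))
  refine (add_le_add q1 q2).trans_eq ?_
  have : y ^ (-α) * y ^ (β - 1) = y ^ (-α - 1) * y ^ β := by
    rw [← Real.rpow_add hk, ← Real.rpow_add hk]; ring_nf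
  have e3 : A * y ^ (-α) * (C₂ * y ^ (β - 1)) / (a * (B * y ^ β)) =
      A * C₂ / B / a * y ^ (-α - 1) := by
    rw [show A * y ^ (-α) * (C₂ * y ^ (β - 1)) = A * C₂ * (y ^ (-α) * y ^ (β - 1)) by ring, this]
    field_simp
  rw [e3]
  ring

/-! ### Beta integrals and the values of `D`. -/

/-- The substitution `x = t² / (1 + t²)` turns this into half of `B(p, 1 - p) = Γ(p) Γ(1 - p) = π /
sin (πp)` with `p = (1 - s) / 2`. -/
theorem integral_Ioi_rpow_div_one_add_sq {s : ℝ} (h₀ : -1 < s) (h₁ : s < 1) :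
    ∫ t in Set.Ioi (0 : ℝ), 1 / (t ^ s * (1 + t ^ 2)) = Real.pi / 2 / Real.cos (Real.pi * s / 2) := by
  set p : ℝ := (1 - s) / 2 with hp
  have hp0 : 0 < p := by linarith
  have hp1 : 0 < 1 - p := by linarith
  have hbeta : ∫ x in Set.Ioo (0 : ℝ) 1, x ^ (p - 1) * (1 - x) ^ (-p) =
      Real.pi / Real.sin (Real.pi * p) := by
    have h := Complex.Gamma_mul_Gamma_eq_betaIntegral (s := p) (t := 1 - p) (by simpa using hp0)
      (by simpa using hp1)
    rw [Complex.Gamma_mul_Gamma_one_sub, add_sub_cancel, Complex.Gamma_one, one_mul,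
      Complex.betaIntegral, intervalIntegral.integral_of_le zero_le_one,
      integral_Ioc_eq_integral_Ioo] at h
    have h2 : ∫ x in Set.Ioo (0 : ℝ) 1, (x : ℂ) ^ ((p : ℂ) - 1) * (1 - (x : ℂ)) ^ (1 - (p : ℂ) - 1) =
        ∫ x in Set.Ioo (0 : ℝ) 1, ((x ^ (p - 1) * (1 - x) ^ (-p) : ℝ) : ℂ) := by
      refine setIntegral_congr_fun measurableSet_Ioo fun x hx => ?_
      rw [Complex.ofReal_mul, Complex.ofReal_cpow hx.1.le, Complex.ofReal_cpow (by linarith [hx.2])]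
      push_cast
      congr 2
      ring
    rw [h2, integral_complex_ofReal] at h
    rw [← Complex.ofReal_inj, ← h]
    push_cast
    rfl
  set f : ℝ → ℝ := fun t => t ^ 2 / (1 + t ^ 2) with hf
  have hderiv : ∀ t ∈ Set.Ioi (0 : ℝ),
      HasDerivWithinAt f (2 * t / (1 + t ^ 2) ^ 2) (Set.Ioi 0) t := by
    intro t _
    have h1 : HasDerivAt (fun t : ℝ => t ^ 2) (2 * t) t := by simpa using hasDerivAt_pow 2 t
    have h2 := (h1.fun_div (h1.const_add 1) (by positivity)).hasDerivWithinAt (s := Set.Ioi 0)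
    convert! h2 using 1
    ring
  have hinj : Set.InjOn f (Set.Ioi 0) := by
    intro x hx y hy hxy
    have hx : 0 < x := hx
    have hy : 0 < y := hy
    simp only [hf] at hxy
    rw [div_eq_div_iff (by positivity) (by positivity)] at hxy
    exact (pow_left_inj₀ hx.le hy.le two_ne_zero).1 (by linarith)
  have himage : f '' Set.Ioi 0 = Set.Ioo 0 1 := by
    ext x
    constructor
    · rintro ⟨t, ht, rfl⟩
      have ht : 0 < t := ht
      refine ⟨by positivity, ?_⟩
      simp only [hf]
      rw [div_lt_one (by positivity)]
      linarith
    · rintro ⟨hx0, hx1⟩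
      have h1 : 0 < 1 - x := by linarith
      refine ⟨Real.sqrt (x / (1 - x)), Real.sqrt_pos.2 (by positivity), ?_⟩
      simp only [hf]
      rw [Real.sq_sqrt (by positivity)]
      field_simp
      ring
  have hcv := integral_image_eq_integral_abs_deriv_smul measurableSet_Ioi hderiv hinj
    (fun x => x ^ (p - 1) * (1 - x) ^ (-p))
  rw [himage, hbeta] at hcv
  have hcongr : ∫ t in Set.Ioi (0 : ℝ), |2 * t / (1 + t ^ 2) ^ 2| •
      (f t ^ (p - 1) * (1 - f t) ^ (-p)) =
      ∫ t in Set.Ioi (0 : ℝ), 2 * (1 / (t ^ s * (1 + t ^ 2))) := by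
    refine setIntegral_congr_fun measurableSet_Ioi fun t ht => ?_
    have ht : 0 < t := ht
    have h2 : 0 < 1 + t ^ 2 := by positivity
    have e1 : 1 - f t = (1 + t ^ 2)⁻¹ := by
      simp only [hf]
      field_simp
      ring
    have e2 : t * (t ^ 2) ^ (p - 1) = (t ^ s)⁻¹ := by
      rw [← Real.rpow_natCast, ← Real.rpow_mul ht.le, ← Real.rpow_neg ht.le]
      nth_rewrite 1 [← Real.rpow_one t]
      rw [← Real.rpow_add ht]
      congr 1
      push_cast
      rw [hp]
      ring
    have e3 : (1 + t ^ 2) ^ (p - 1) = (1 + t ^ 2) ^ p / (1 + t ^ 2) := by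
      rw [Real.rpow_sub h2, Real.rpow_one]
    have e4 : 0 < (1 + t ^ 2) ^ p := Real.rpow_pos_of_pos h2 p
    simp only [smul_eq_mul]
    rw [abs_of_nonneg (by positivity), e1]
    simp only [hf]
    rw [Real.div_rpow (by positivity) h2.le, Real.inv_rpow h2.le, Real.rpow_neg h2.le, inv_inv, e3]
    have e5 : (t ^ 2) ^ (p - 1) = (t ^ s)⁻¹ / t := by
      rw [← e2]
      field_simp
    rw [e5]
    have := Real.rpow_pos_of_pos ht s
    field_simp
  rw [hcongr, integral_const_mul] at hcv
  have hsin : Real.sin (Real.pi * p) = Real.cos (Real.pi * s / 2) := by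
    rw [← Real.cos_pi_div_two_sub]
    congr 1
    rw [hp]
    ring
  rw [hsin] at hcv
  rw [div_right_comm, hcv]
  ring

theorem cos_pi_mul_half_pos {s : ℝ} (h₀ : -1 < s) (h₁ : s < 1) : 0 < Real.cos (Real.pi * s / 2) := by
  have := Real.pi_pos
  exact Real.cos_pos_of_mem_Ioo ⟨by nlinarith, by nlinarith⟩

theorem integrableOn_Ioi_rpow_div_one_add_sq {s : ℝ} (h₀ : -1 < s) (h₁ : s < 1) :
    IntegrableOn (fun t : ℝ => 1 / (t ^ s * (1 + t ^ 2))) (Set.Ioi 0) := by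
  -- The integral of a non-integrable function is `0` by convention, so the nonzero value already
  -- computed forces integrability.
  refine Integrable.of_integral_ne_zero ?_
  rw [integral_Ioi_rpow_div_one_add_sq h₀ h₁]
  have := cos_pi_mul_half_pos h₀ h₁
  have := Real.pi_pos
  positivity

theorem integrableOn_Ioi_ofReal_rpow_div_one_add_sq {s : ℝ} (h₀ : -1 < s) (h₁ : s < 1) :
    IntegrableOn (fun t : ℝ => ((1 / (t ^ s * (1 + t ^ 2)) : ℝ) : ℂ)) (Set.Ioi 0) :=
  (integrableOn_Ioi_rpow_div_one_add_sq h₀ h₁).ofReal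

theorem one_div_rpow_mul_I_add {r t : ℝ} (ht : 0 < t) :
    1 / (((t ^ r : ℝ) : ℂ) * (Complex.I + (t : ℂ))) =
      ((1 / (t ^ (r - 1) * (1 + t ^ 2)) : ℝ) : ℂ)
        - Complex.I * ((1 / (t ^ r * (1 + t ^ 2)) : ℝ) : ℂ) := by
  have h1 := Real.rpow_pos_of_pos ht r
  have h2 : (Complex.I + (t : ℂ)) ≠ 0 := fun h => by
    have := congrArg Complex.im h
    simp at this
  have e : t ^ (r - 1) = t ^ r / t := by rw [Real.rpow_sub ht, Real.rpow_one]
  have e' : (1 + (t : ℂ) ^ 2) = (Complex.I + t) * (t - Complex.I) := by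
    linear_combination Complex.I_sq
  have h3 : ((t : ℂ) - Complex.I) ≠ 0 := fun h => by
    have := congrArg Complex.im h
    simp at this
  have h4 : ((t ^ r : ℝ) : ℂ) ≠ 0 := by exact_mod_cast h1.ne'
  have h5 : (t : ℂ) ≠ 0 := by exact_mod_cast ht.ne'
  rw [e]
  push_cast
  rw [e']
  field_simp

theorem constD_eq_integrals {r : ℝ} (h₀ : 0 < r) (h₁ : r < 1) :
    constD r = 1 / 2 * (((∫ t in Set.Ioi (0 : ℝ), 1 / (t ^ r * (1 + t ^ 2)) : ℝ) : ℂ)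
      + Complex.I * ((∫ t in Set.Ioi (0 : ℝ), 1 / (t ^ (r - 1) * (1 + t ^ 2)) : ℝ) : ℂ)) := by
  have i1 := integrableOn_Ioi_ofReal_rpow_div_one_add_sq (s := r) (by linarith) h₁
  have i2 := integrableOn_Ioi_ofReal_rpow_div_one_add_sq (s := r - 1) (by linarith) (by linarith)
  have h : ∫ t in Set.Ioi (0 : ℝ), 1 / (((t ^ r : ℝ) : ℂ) * (Complex.I + (t : ℂ))) =
      ∫ t in Set.Ioi (0 : ℝ), (((1 / (t ^ (r - 1) * (1 + t ^ 2)) : ℝ) : ℂ)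
        - Complex.I * ((1 / (t ^ r * (1 + t ^ 2)) : ℝ) : ℂ)) :=
    setIntegral_congr_fun measurableSet_Ioi fun t ht => one_div_rpow_mul_I_add ht
  rw [constD, h, integral_sub i2 (Integrable.const_mul i1 Complex.I), integral_const_mul,
    integral_complex_ofReal, integral_complex_ofReal]
  linear_combination (-(1 / 2) * ((∫ t in Set.Ioi (0 : ℝ), 1 / (t ^ r * (1 + t ^ 2)) : ℝ) : ℂ)) *
    Complex.I_sq

theorem constD_eq_exp {r : ℝ} (h₀ : 0 < r) (h₁ : r < 1) :
    constD r = (Real.pi / 2 : ℂ) * Complex.exp (Complex.I * (Real.pi / 2) * (1 - (r : ℂ)))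
      / ((Real.sin (Real.pi * r) : ℝ) : ℂ) := by
  rw [constD_eq_integrals h₀ h₁, integral_Ioi_rpow_div_one_add_sq (by linarith) h₁,
    integral_Ioi_rpow_div_one_add_sq (by linarith) (by linarith)]
  have hcos : 0 < Real.cos (Real.pi * r / 2) := cos_pi_mul_half_pos (by linarith) h₁
  have hsin : 0 < Real.cos (Real.pi * (r - 1) / 2) :=
    cos_pi_mul_half_pos (by linarith) (by linarith)
  have e1 : Real.cos (Real.pi * (r - 1) / 2) = Real.sin (Real.pi * r / 2) := by
    rw [← Real.cos_sub_pi_div_two]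
    ring_nf
  rw [e1] at hsin ⊢
  have e2 : Real.sin (Real.pi * r) = 2 * Real.sin (Real.pi * r / 2) * Real.cos (Real.pi * r / 2) := by
    rw [← Real.sin_two_mul]
    ring_nf
  have e3 : Complex.exp (Complex.I * (Real.pi / 2) * (1 - (r : ℂ))) =
      (Real.sin (Real.pi * r / 2) : ℂ) + (Real.cos (Real.pi * r / 2) : ℂ) * Complex.I := by
    rw [show Complex.I * (Real.pi / 2) * (1 - (r : ℂ)) =
      ((Real.pi / 2 - Real.pi * r / 2 : ℝ) : ℂ) * Complex.I by push_cast; ring,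
      Complex.exp_mul_I, ← Complex.ofReal_cos, ← Complex.ofReal_sin, Real.cos_pi_div_two_sub,
      Real.sin_pi_div_two_sub]
  rw [e2, e3]
  push_cast
  have hc' : Complex.cos (Real.pi * r / 2) ≠ 0 := by
    have := Complex.ofReal_ne_zero.2 hcos.ne'
    push_cast at this
    exact this
  have hs' : Complex.sin (Real.pi * r / 2) ≠ 0 := by
    have := Complex.ofReal_ne_zero.2 hsin.ne'
    push_cast at this
    exact this
  field_simp

/-! ### Evaluating the model integral. -/

/-- Substitute `t = (B/a) x^β`; the relation `β r = α + β - 1` is exactly what turns `x^(-α) dx`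
into a multiple of `t^(-r) dt`. -/
theorem integral_Ioi_zero_modelTerm {α β B a r : ℝ} (hβ : 0 < β) (hB : 0 < B) (ha : 0 < a)
    (hr : β * r = α + β - 1) :
    ∫ x in Set.Ioi (0 : ℝ), modelTerm α β B a x =
      ((1 / (β * B ^ (1 - r)) * a ^ (-r) : ℝ) : ℂ) *
        ∫ t in Set.Ioi (0 : ℝ), 1 / (((t ^ r : ℝ) : ℂ) * (Complex.I + (t : ℂ))) := by
  set G : ℝ → ℂ := fun t => 1 / (((t ^ r : ℝ) : ℂ) * (Complex.I + (t : ℂ))) with hG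
  have hκ : 0 < B / a := by positivity
  have h1 := integral_comp_mul_left_Ioi G 0 hκ
  rw [mul_zero] at h1
  have h2 := integral_comp_rpow_Ioi_of_pos (g := fun u => G (B / a * u)) hβ
  rw [h1] at h2
  have h3 : ∫ x in Set.Ioi (0 : ℝ), (β * x ^ (β - 1)) • G (B / a * x ^ β) =
      ∫ x in Set.Ioi (0 : ℝ), ((β * (B / a) ^ (-r) * a : ℝ) : ℂ) * modelTerm α β B a x := by
    refine setIntegral_congr_fun measurableSet_Ioi fun x hx => ?_
    have hx : 0 < x := hx
    have hxβ := Real.rpow_pos_of_pos hx β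
    have e1 : (B / a * x ^ β) ^ r = (B / a) ^ r * x ^ (α + β - 1) := by
      rw [Real.mul_rpow hκ.le hxβ.le, ← Real.rpow_mul hx.le, hr]
    have e2 : x ^ (β - 1) = x ^ (-α) * x ^ (α + β - 1) := by
      rw [← Real.rpow_add hx]
      ring_nf
    have p1 := Real.rpow_pos_of_pos hκ r
    have p2 := Real.rpow_pos_of_pos hx (α + β - 1)
    have n1 := Complex.ofReal_ne_zero.2 p1.ne'
    have n2 := Complex.ofReal_ne_zero.2 p2.ne'
    have n3 : (a : ℂ) ≠ 0 := Complex.ofReal_ne_zero.2 ha.ne'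
    have n4 := I_mul_add_ne_zero ha (B * x ^ β)
    have e3 : Complex.I + ((B / a * x ^ β : ℝ) : ℂ) =
        (Complex.I * a + ((B * x ^ β : ℝ) : ℂ)) / a := by
      push_cast
      field_simp
    simp only [hG, modelTerm]
    rw [e1, e2, e3, Real.rpow_neg hκ.le, Complex.real_smul]
    generalize (B / a) ^ r = u at *
    generalize x ^ (α + β - 1) = v at *
    generalize Complex.I * a + ((B * x ^ β : ℝ) : ℂ) = w at *
    push_cast
    field_simp
  rw [h3, integral_const_mul] at h2
  have p1 := Real.rpow_pos_of_pos hκ (-r)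
  have hne : ((β * (B / a) ^ (-r) * a : ℝ) : ℂ) ≠ 0 := by
    exact_mod_cast (by positivity : β * (B / a) ^ (-r) * a ≠ 0)
  rw [← mul_right_inj' hne, h2, Complex.real_smul, ← mul_assoc, ← Complex.ofReal_mul]
  congr 2
  rw [Real.div_rpow hB.le ha.le, Real.rpow_sub hB, Real.rpow_one, Real.rpow_neg hB.le]
  have p2 := Real.rpow_pos_of_pos hB r
  have p3 := Real.rpow_pos_of_pos ha (-r)
  field_simp

theorem integrableOn_rpow_neg_Ioc {α : ℝ} (hα : α < 1) :
    IntegrableOn (fun x : ℝ => x ^ (-α)) (Set.Ioc 0 1) :=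
  (intervalIntegrable_iff_integrableOn_Ioc_of_le zero_le_one).1
    (intervalIntegral.intervalIntegrable_rpow' (by linarith))

theorem integrableOn_modelTerm_Ioc {α β B a : ℝ} (ha : 0 < a) (hα : α < 1) :
    IntegrableOn (modelTerm α β B a) (Set.Ioc 0 1) := by
  refine ((integrableOn_rpow_neg_Ioc hα).div_const a).mono' (((continuousOn_modelTerm ha).mono
    Set.Ioc_subset_Ioi_self).aestronglyMeasurable measurableSet_Ioc) ?_
  filter_upwards [ae_restrict_mem measurableSet_Ioc] with x hx
  exact norm_modelTerm_le ha hx.1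

theorem norm_integral_Ioi_one_modelTerm_sub_le {α β B a : ℝ} (hB : 0 < B) (ha : 0 < a)
    (hαβ : 1 < α + β) (hα : α < 1) :
    ‖(∫ x in Set.Ioi (1 : ℝ), modelTerm α β B a x) - ∫ x in Set.Ioi (0 : ℝ), modelTerm α β B a x‖ ≤
      (∫ x in Set.Ioc (0 : ℝ) 1, x ^ (-α)) / a := by
  rw [← Set.Ioc_union_Ioi_eq_Ioi zero_le_one, setIntegral_union (Set.Ioc_disjoint_Ioi le_rfl)
    measurableSet_Ioi (integrableOn_modelTerm_Ioc ha hα) (integrableOn_modelTerm hB ha hαβ),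
    sub_add_cancel_right, norm_neg, ← integral_div]
  refine norm_integral_le_of_norm_le ((integrableOn_rpow_neg_Ioc hα).div_const a) ?_
  filter_upwards [ae_restrict_mem measurableSet_Ioc] with x hx
  exact norm_modelTerm_le ha hx.1

/-- For `α = 1` the integrand has the primitive `-log (B + ia x^(-β)) / (iaβ)`; its argument has
real part `B > 0`, so the principal branch is differentiable along the path. -/
theorem integral_Ioi_one_modelTerm_one {β B a : ℝ} (hβ : 0 < β) (hB : 0 < B) (ha : 0 < a) :
    ∫ x in Set.Ioi (1 : ℝ), modelTerm 1 β B a x =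
      (Complex.log (B + Complex.I * a) - Complex.log B) / (Complex.I * a * β) := by
  have haC : (a : ℂ) ≠ 0 := Complex.ofReal_ne_zero.2 ha.ne'
  have hβC : (β : ℂ) ≠ 0 := Complex.ofReal_ne_zero.2 hβ.ne'
  have hderiv : ∀ x ∈ Set.Ici (1 : ℝ), HasDerivAt
      (fun x : ℝ => -(Complex.log (B + Complex.I * a * ((x ^ (-β) : ℝ) : ℂ)) / (Complex.I * a * β)))
      (modelTerm 1 β B a x) x := by
    intro x hx
    have hx : 0 < x := zero_lt_one.trans_le hx
    have h1 := (Real.hasDerivAt_rpow_const (p := -β) (Or.inl hx.ne')).ofReal_comp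
    have h2 := ((h1.const_mul (Complex.I * a)).const_add (B : ℂ))
    have hs : (B : ℂ) + Complex.I * a * ((x ^ (-β) : ℝ) : ℂ) ∈ Complex.slitPlane :=
      Or.inl (by simpa using hB)
    have h3 := ((h2.clog_real hs).div_const (Complex.I * a * β)).neg
    convert! h3 using 1
    have p1 := Real.rpow_pos_of_pos hx β
    have n1 := Complex.ofReal_ne_zero.2 p1.ne'
    have n2 := Complex.ofReal_ne_zero.2 hx.ne'
    have n3 := Complex.slitPlane_ne_zero hs
    have n4 := I_mul_add_ne_zero ha (B * x ^ β)
    rw [Real.rpow_sub hx, Real.rpow_neg hx.le, Real.rpow_one] at *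
    rw [modelTerm, Real.rpow_neg hx.le, Real.rpow_one]
    generalize x ^ β = v at *
    have e : Complex.I * a + ((B * v : ℝ) : ℂ) = v * (B + Complex.I * a * ((v⁻¹ : ℝ) : ℂ)) := by
      push_cast
      field_simp
      ring
    rw [e]
    generalize (B : ℂ) + Complex.I * a * ((v⁻¹ : ℝ) : ℂ) = w at *
    push_cast
    field_simp
  have hlim : Tendsto (fun x : ℝ => -(Complex.log (B + Complex.I * a * ((x ^ (-β) : ℝ) : ℂ))
      / (Complex.I * a * β))) atTop (nhds (-(Complex.log B / (Complex.I * a * β)))) := by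
    have h1 : Tendsto (fun x : ℝ => ((x ^ (-β) : ℝ) : ℂ)) atTop (nhds 0) := by
      exact_mod_cast (Complex.continuous_ofReal.tendsto 0).comp (tendsto_rpow_neg_atTop hβ)
    have h2 : Tendsto (fun x : ℝ => (B : ℂ) + Complex.I * a * ((x ^ (-β) : ℝ) : ℂ)) atTop
        (nhds (B : ℂ)) := by
      simpa using (h1.const_mul (Complex.I * a)).const_add (B : ℂ)
    exact ((h2.clog (Or.inl (by simpa using hB))).div_const _).neg
  rw [integral_Ioi_of_hasDerivAt_of_tendsto' hderiv
    (integrableOn_modelTerm hB ha (by linarith)) hlim]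
  simp
  ring

theorem norm_integral_Ioi_one_modelTerm_one_sub_le {β B a : ℝ} (hβ : 0 < β) (hB : 0 < B)
    (ha : 1 ≤ a) :
    ‖(∫ x in Set.Ioi (1 : ℝ), modelTerm 1 β B a x) - Real.log a / (Complex.I * a * β)‖ ≤
      ((Real.log (B + 1) + Real.pi + |Real.log B|) / β) / a := by
  have ha0 : 0 < a := by linarith
  rw [integral_Ioi_one_modelTerm_one hβ hB ha0, ← sub_div, norm_div, norm_mul, norm_mul,
    Complex.norm_I, one_mul, Complex.norm_real, Complex.norm_real, Real.norm_of_nonneg ha0.le,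
    Real.norm_of_nonneg hβ.le, div_div, mul_comm β a]
  refine div_le_div_of_nonneg_right ?_ (by positivity)
  set z : ℂ := B + Complex.I * a with hz
  have hz1 : a ≤ ‖z‖ := by
    rw [hz, add_comm]
    exact le_norm_I_mul_add_left a B
  have hz2 : ‖z‖ ≤ (B + 1) * a := by
    have := norm_add_le (B : ℂ) (Complex.I * a)
    rw [norm_mul, Complex.norm_I, one_mul, Complex.norm_real, Complex.norm_real,
      Real.norm_of_nonneg ha0.le, Real.norm_of_nonneg hB.le] at this
    nlinarith
  have hlog1 : Real.log a ≤ Real.log ‖z‖ := Real.log_le_log ha0 hz1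
  have hlog2 : Real.log ‖z‖ ≤ Real.log (B + 1) + Real.log a := by
    rw [← Real.log_mul (by positivity) ha0.ne']
    exact Real.log_le_log (ha0.trans_le hz1) hz2
  have e : Complex.log z - Complex.log B - (Real.log a : ℂ) =
      ((Real.log ‖z‖ - Real.log a : ℝ) : ℂ) + ((z.arg : ℝ) : ℂ) * Complex.I
        - ((Real.log B : ℝ) : ℂ) := by
    rw [Complex.log, Complex.ofReal_log hB.le]
    push_cast
    ring
  rw [e]
  refine (norm_sub_le _ _).trans (add_le_add ((norm_add_le _ _).trans (add_le_add ?_ ?_)) ?_)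
  · rw [Complex.norm_real, Real.norm_of_nonneg (by linarith)]
    linarith
  · rw [norm_mul, Complex.norm_I, mul_one, Complex.norm_real]
    exact Complex.abs_arg_le_pi z
  · rw [Complex.norm_real, Real.norm_eq_abs]

theorem tendsto_atTop_of_isBigO_sub_rpow {B β : ℝ} (hB : 0 < B) (hβ : 0 < β) {γ : ℕ → ℝ}
    (hγO : (fun k : ℕ => γ k - B * ((k : ℝ) + 1) ^ β) =O[atTop]
      fun k : ℕ => ((k : ℝ) + 1) ^ (β - 1)) : Tendsto γ atTop atTop := by
  obtain ⟨C, hC, h⟩ := bound_of_isBigO_nat_atTop hγO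
  have hy : Tendsto (fun k : ℕ => (k : ℝ) + 1) atTop atTop :=
    tendsto_atTop_add_const_right _ _ tendsto_natCast_atTop_atTop
  have h1 : Tendsto (fun k : ℕ => B / 2 * ((k : ℝ) + 1) ^ β) atTop atTop :=
    ((tendsto_rpow_atTop hβ).comp hy).const_mul_atTop (by positivity)
  refine tendsto_atTop_mono' _ ?_ h1
  -- Beyond this threshold the error `C y^(β-1)` is at most half of `B y^β`.
  filter_upwards [hy.eventually_ge_atTop (2 * C / B)] with k hk
  have hk0 : (0 : ℝ) < (k : ℝ) + 1 := by positivity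
  have p1 := Real.rpow_pos_of_pos hk0 (β - 1)
  have h2 := h (x := k) p1.ne'
  rw [Real.norm_of_nonneg p1.le] at h2
  have h3 := (abs_le.1 h2).1
  have e : ((k : ℝ) + 1) ^ β = ((k : ℝ) + 1) ^ (β - 1) * ((k : ℝ) + 1) := by
    rw [← Real.rpow_add_one hk0.ne', sub_add_cancel]
  rw [div_le_iff₀ hB] at hk
  rw [e] at h3 ⊢
  nlinarith

/-! ### Expansion of `K(ia)`, and the zeros for large `a`. -/

section

variable {A B α β r : ℝ} (hA : 0 < A) (hB : 0 < B) (hα : 0 < α) (hβ : 0 < β) (hαβ : 1 < α + β)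
  {c γ : ℕ → ℝ} (hc : ∀ k, 0 < c k) (hγ : ∀ k, 0 < γ k) (hm : StrictMono γ)
  (ht : Tendsto γ atTop atTop) (hs : Summable fun k => c k / γ k)
  (hcO : (fun k : ℕ => c k - A * ((k : ℝ) + 1) ^ (-α)) =O[atTop]
    fun k : ℕ => ((k : ℝ) + 1) ^ (-α - 1))
  (hγO : (fun k : ℕ => γ k - B * ((k : ℝ) + 1) ^ β) =O[atTop]
    fun k : ℕ => ((k : ℝ) + 1) ^ (β - 1))

include hA hB hα hβ hαβ hc ht hs hcO hγO in
theorem exists_norm_Khat_sub_integral_le : ∃ C, ∀ a : ℝ, 0 < a →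
    ‖Khat c γ (Complex.I * a) - A * ∫ x in Set.Ioi 1, modelTerm α β B a x‖ ≤ C / a := by
  obtain ⟨C, hC⟩ := exists_norm_Khat_sub_tsum_modelTerm_le hA hB hα hαβ hc ht hs hcO hγO
  refine ⟨C + A * ((α + β) * (∑' k : ℕ, ((k : ℝ) + 1) ^ (-α - 1))), fun a ha => ?_⟩
  have h1 := hC a ha
  have h2 := norm_tsum_modelTerm_sub_integral_le hα hβ hB hαβ ha
  have h3 := mul_le_mul_of_nonneg_left h2 hA.le
  rw [add_div, mul_div_assoc A]
  refine (norm_sub_le_norm_sub_add_norm_sub _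
    (A * ∑' k : ℕ, modelTerm α β B a ((k : ℝ) + 1)) _).trans (add_le_add h1 ?_)
  rw [← mul_sub, norm_mul, Complex.norm_real, Real.norm_of_nonneg hA.le]
  exact h3

include hA hB hα hβ hαβ hc ht hs hcO hγO in
/-- Asymptotics of `Khat` on the imaginary axis if `α < 1`. -/
theorem exists_norm_Khat_sub_rpow_le (hα₁ : α < 1) (hr : β * r = α + β - 1) :
    ∃ C, ∀ a : ℝ, 0 < a → ‖Khat c γ (Complex.I * a) -
      A * (((1 / (β * B ^ (1 - r)) * a ^ (-r) : ℝ) : ℂ) *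
        ∫ t in Set.Ioi (0 : ℝ), 1 / (((t ^ r : ℝ) : ℂ) * (Complex.I + (t : ℂ))))‖ ≤ C / a := by
  obtain ⟨C, hC⟩ := exists_norm_Khat_sub_integral_le hA hB hα hβ hαβ hc ht hs hcO hγO
  refine ⟨C + A * (∫ x in Set.Ioc (0 : ℝ) 1, x ^ (-α)), fun a ha => ?_⟩
  rw [← integral_Ioi_zero_modelTerm hβ hB ha hr, add_div, mul_div_assoc A]
  refine (norm_sub_le_norm_sub_add_norm_sub _
    (A * ∫ x in Set.Ioi 1, modelTerm α β B a x) _).trans (add_le_add (hC a ha) ?_)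
  rw [← mul_sub, norm_mul, Complex.norm_real, Real.norm_of_nonneg hA.le]
  exact mul_le_mul_of_nonneg_left (norm_integral_Ioi_one_modelTerm_sub_le hB ha hαβ hα₁) hA.le

include hA hB hα hβ hαβ hc ht hs hcO hγO in
/-- Asymptotics of `Khat` on the imaginary axis if `α = 1`. -/
theorem exists_norm_Khat_sub_log_le (hα₁ : α = 1) :
    ∃ C, ∀ a : ℝ, 1 ≤ a → ‖Khat c γ (Complex.I * a) -
      A * (Real.log a / (Complex.I * a * β))‖ ≤ C / a := by
  obtain ⟨C, hC⟩ := exists_norm_Khat_sub_integral_le hA hB hα hβ hαβ hc ht hs hcO hγO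
  subst hα₁
  refine ⟨C + A * ((Real.log (B + 1) + Real.pi + |Real.log B|) / β), fun a ha => ?_⟩
  rw [add_div, mul_div_assoc A]
  refine (norm_sub_le_norm_sub_add_norm_sub _
    (A * ∫ x in Set.Ioi 1, modelTerm 1 β B a x) _).trans
    (add_le_add (hC a (by linarith)) ?_)
  rw [← mul_sub, norm_mul, Complex.norm_real, Real.norm_of_nonneg hA.le]
  exact mul_le_mul_of_nonneg_left (norm_integral_Ioi_one_modelTerm_one_sub_le hβ hB ha) hA.le

include hA hB hα hβ hαβ hc ht hs hcO hγO in
theorem exists_norm_Khat_le_rpow (hα₁ : α < 1) (hr : β * r = α + β - 1) :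
    ∃ C, ∀ a : ℝ, 1 ≤ a → ‖Khat c γ (Complex.I * a)‖ ≤ C * a ^ (-r) := by
  obtain ⟨C, hC⟩ := exists_norm_Khat_sub_rpow_le hA hB hα hβ hαβ hc ht hs hcO hγO hα₁ hr
  set J := ∫ t in Set.Ioi (0 : ℝ), 1 / (((t ^ r : ℝ) : ℂ) * (Complex.I + (t : ℂ)))
  have hC0 : 0 ≤ C := by simpa using (norm_nonneg _).trans (hC 1 one_pos)
  have hr1 : r ≤ 1 := by nlinarith
  refine ⟨C + A * (1 / (β * B ^ (1 - r))) * ‖J‖, fun a ha => ?_⟩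
  have ha0 : 0 < a := by linarith
  have p1 := Real.rpow_pos_of_pos ha0 (-r)
  have p2 := Real.rpow_pos_of_pos hB (1 - r)
  have h1 : C / a ≤ C * a ^ (-r) := by
    rw [div_eq_mul_inv, ← Real.rpow_neg_one]
    exact mul_le_mul_of_nonneg_left (Real.rpow_le_rpow_of_exponent_le ha (by linarith)) hC0
  have h2 := norm_sub_norm_le (Khat c γ (Complex.I * a))
    (A * (((1 / (β * B ^ (1 - r)) * a ^ (-r) : ℝ) : ℂ) * J))
  have h3 := hC a ha0
  rw [norm_mul, norm_mul, Complex.norm_real, Complex.norm_real, Real.norm_of_nonneg hA.le,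
    Real.norm_of_nonneg (by positivity : 0 ≤ 1 / (β * B ^ (1 - r)) * a ^ (-r))] at h2
  linarith

include hA hB hα hβ hαβ hc ht hs hcO hγO in
-- The logarithm is traded for half a power. The exponent suffices: the squared error becomes
-- `a^(4ξ-4)`, and `4ξ - 4 ≤ 2ξ - 2` for `ξ < 1`.
theorem exists_norm_Khat_le_rpow_neg_half (hα₁ : α = 1) :
    ∃ C, ∀ a : ℝ, 1 ≤ a → ‖Khat c γ (Complex.I * a)‖ ≤ C * a ^ (-(1 / 2 : ℝ)) := by
  obtain ⟨C, hC⟩ := exists_norm_Khat_sub_log_le hA hB hα hβ hαβ hc ht hs hcO hγO hα₁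
  have hC0 : 0 ≤ C := by simpa using (norm_nonneg _).trans (hC 1 le_rfl)
  refine ⟨C + A * (2 / β), fun a ha => ?_⟩
  have ha0 : 0 < a := by linarith
  have h1 : C / a ≤ C * a ^ (-(1 / 2 : ℝ)) := by
    rw [div_eq_mul_inv, ← Real.rpow_neg_one]
    exact mul_le_mul_of_nonneg_left
      (Real.rpow_le_rpow_of_exponent_le ha (by norm_num)) hC0
  have h2 := norm_sub_norm_le (Khat c γ (Complex.I * a)) (A * (Real.log a / (Complex.I * a * β)))
  have h3 := hC a ha
  have h4 : Real.log a / (a * β) ≤ 2 / β * a ^ (-(1 / 2 : ℝ)) := by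
    have h5 := Real.log_le_rpow_div ha0.le (by norm_num : (0 : ℝ) < 1 / 2)
    have h6 : a ^ (1 / 2 : ℝ) = a * a ^ (-(1 / 2 : ℝ)) := by
      nth_rewrite 2 [← Real.rpow_one a]
      rw [← Real.rpow_add ha0]
      norm_num
    rw [h6] at h5
    rw [div_le_iff₀ (by positivity)]
    refine h5.trans_eq ?_
    field_simp
  have h7 := mul_le_mul_of_nonneg_left h4 hA.le
  rw [norm_mul, norm_div, norm_mul, norm_mul, Complex.norm_I, one_mul, Complex.norm_real,
    Complex.norm_real, Complex.norm_real, Complex.norm_real, Real.norm_of_nonneg hA.le,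
    Real.norm_of_nonneg ha0.le, Real.norm_of_nonneg hβ.le,
    Real.norm_of_nonneg (Real.log_nonneg ha)] at h2
  linarith

include hc hγ hm ht hs in
/-- The zeros of `fSym` and `ell` for all large values of the parameter. -/
theorem eventually_exists_zeros {ξ : ℝ} (hξ₁ : ξ < 1) :
    ∀ᶠ a : ℝ in atTop, ∃ (d : (ℕ → ℝ) × (ℕ → ℝ) × ℂ),
      {t : ℝ | (t : ℂ) ∈ zerosOff γ (fSym a ξ c γ)} = Set.range d.2.1 ∧
      zerosOff γ (ell a ξ c γ) = Set.range (fun k => (d.1 k : ℂ)) ∪ {d.2.2, conj d.2.2} ∧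
      (∀ k, -γ k < d.1 k ∧ d.1 k < d.2.1 k) ∧ (∀ k, d.2.1 (k + 1) < -γ k) ∧ d.2.1 0 < 0 ∧
      0 < d.2.2.im ∧
      ‖d.2.2 - (Complex.I * a +
        ((a ^ (2 * ξ) : ℝ) : ℂ) * Khat c γ (Complex.I * a) / (2 * Complex.I * a))‖ ≤
        24 * (a ^ (2 * ξ)) ^ 2 * ‖Khat c γ (Complex.I * a)‖ ^ 2 / a ^ 3 := by
  set S := ∑' k, c k / γ k with hS
  have hS0 : 0 ≤ S := tsum_nonneg fun k => (div_pos (hc k) (hγ k)).le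
  have hlim : Tendsto (fun a : ℝ => 1 / a ^ (2 * (1 - ξ)) * S) atTop (nhds 0) := by
    have := (tendsto_rpow_neg_atTop (by linarith : 0 < 2 * (1 - ξ))).mul_const S
    rw [zero_mul] at this
    refine this.congr' ?_
    filter_upwards [eventually_gt_atTop 0] with a ha
    rw [Real.rpow_neg ha.le, one_div]
  -- Because `‖K(ia)‖ ≤ 2S`, the bound `1/128` yields the `1/64` required by the contraction.
  filter_upwards [eventually_gt_atTop 0,
    hlim.eventually_lt_const (by norm_num : (0 : ℝ) < 1 / 128)] with a ha hsm
  have hb : 0 < a ^ (2 * ξ) := by positivity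
  have hba : a ^ (2 * ξ) = a ^ 2 * (1 / a ^ (2 * (1 - ξ))) := by
    rw [show 2 * (1 - ξ) = 2 - 2 * ξ by ring, Real.rpow_sub ha, Real.rpow_two]
    field_simp
  have hK : ‖Khat c γ (Complex.I * a)‖ ≤ 2 * S := by
    refine (norm_Khat_le hc hγ hs ha (by rw [sub_self, norm_zero]; positivity)).trans ?_
    refine mul_le_mul_of_nonneg_left ?_ zero_le_two
    exact (summable_div_max hc hγ hs a).tsum_le_tsum
      (fun k => div_le_div_of_nonneg_left (hc k).le (hγ k) (le_max_right _ _)) hs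
  have hsmall : a ^ (2 * ξ) * ‖Khat c γ (Complex.I * a)‖ ≤ a ^ 2 / 64 := by
    have h1 : 1 / a ^ (2 * (1 - ξ)) * ‖Khat c γ (Complex.I * a)‖ ≤ 1 / 64 := by
      have := mul_le_mul_of_nonneg_left hK (by positivity : 0 ≤ 1 / a ^ (2 * (1 - ξ)))
      linarith
    have := mul_le_mul_of_nonneg_left h1 (sq_nonneg a)
    rw [hba, mul_assoc]
    linarith
  obtain ⟨w, hw, hw0, hwn⟩ := exists_zero_near_I_mul hc hγ ht hs ha hb hsmall
  have hell : ell a ξ c γ w = 0 := by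
    rw [← hw0, hba, ell, fSym]
    push_cast
    ring
  obtain ⟨lam, x, h1, h2, h3, h4, h5⟩ :=
    exists_zeros_fSym_ell hc hγ hm ht hs ha (by linarith) hw hell
  exact ⟨(lam, x, w), h1, h2, h3, h4, h5, hw, hwn⟩

end

/-! ### From the expansion of `K(ia)` to that of the zeros. -/

/-- The expansion of the non-real zero, from an expansion of `Khat` on the imaginary axis. -/
theorem isBigO_nonreal_zero_sub {c γ : ℕ → ℝ} {ξ q e C C' : ℝ} {m : ℝ → ℂ}
    (h₁ : ∀ a : ℝ, 1 ≤ a → ‖Khat c γ (Complex.I * a) - m a‖ ≤ C / a)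
    (h₂ : ∀ a : ℝ, 1 ≤ a → ‖Khat c γ (Complex.I * a)‖ ≤ C' * a ^ (-q))
    (he : 2 * ξ - 2 ≤ e) (he' : 4 * ξ - 3 - 2 * q ≤ e) {a : ℕ → ℝ} (ha : Tendsto a atTop atTop)
    {w : ℕ → ℂ} (hw : ∀ᶠ n in atTop, ‖w n - (Complex.I * a n +
        ((a n ^ (2 * ξ) : ℝ) : ℂ) * Khat c γ (Complex.I * a n) / (2 * Complex.I * a n))‖ ≤
        24 * (a n ^ (2 * ξ)) ^ 2 * ‖Khat c γ (Complex.I * a n)‖ ^ 2 / a n ^ 3) :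
    (fun n => w n - (Complex.I * a n +
        ((a n ^ (2 * ξ) : ℝ) : ℂ) * m (a n) / (2 * Complex.I * a n))) =O[atTop]
      fun n => a n ^ e := by
  have hC0 : 0 ≤ C := by simpa using (norm_nonneg _).trans (h₁ 1 le_rfl)
  refine IsBigO.of_bound (24 * C' ^ 2 + C) ?_
  filter_upwards [hw, ha.eventually_ge_atTop 1] with n hn ha1
  generalize a n = x at *
  have hx : 0 < x := by linarith
  rw [Real.norm_of_nonneg (Real.rpow_pos_of_pos hx e).le, add_mul]
  -- The fixed-point remainder has order `a^(4ξ-3-2q)`; replacing `Khat` by `m` costs `a^(2ξ) ·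
  -- (1/a) / a = a^(2ξ-2)`.
  refine (norm_sub_le_norm_sub_add_norm_sub _ _ _).trans (add_le_add (hn.trans ?_) ?_)
  · have hp : (x ^ (2 * ξ)) ^ 2 * (x ^ (-q)) ^ 2 / x ^ 3 ≤ x ^ e := by
      rw [← Real.rpow_natCast, ← Real.rpow_natCast, ← Real.rpow_natCast, ← Real.rpow_mul hx.le,
        ← Real.rpow_mul hx.le, ← Real.rpow_add hx, ← Real.rpow_sub hx]
      refine Real.rpow_le_rpow_of_exponent_le ha1 ?_
      push_cast
      linarith
    calc _ ≤ 24 * (x ^ (2 * ξ)) ^ 2 * (C' * x ^ (-q)) ^ 2 / x ^ 3 := by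
          gcongr
          exact h₂ x ha1
      _ = 24 * C' ^ 2 * ((x ^ (2 * ξ)) ^ 2 * (x ^ (-q)) ^ 2 / x ^ 3) := by ring
      _ ≤ _ := by gcongr
  · rw [add_sub_add_left_eq_sub, ← sub_div, ← mul_sub, norm_div, norm_mul, norm_mul, norm_mul,
      Complex.norm_I, Complex.norm_real, Complex.norm_real, Real.norm_of_nonneg hx.le,
      Real.norm_of_nonneg (Real.rpow_pos_of_pos hx (2 * ξ)).le, Complex.norm_ofNat, mul_one]
    have hp : x ^ (2 * ξ) / x ^ 2 ≤ x ^ e := by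
      rw [← Real.rpow_natCast, ← Real.rpow_sub hx]
      exact Real.rpow_le_rpow_of_exponent_le ha1 (by push_cast; linarith)
    have hp0 := Real.rpow_pos_of_pos hx (2 * ξ)
    calc _ ≤ x ^ (2 * ξ) * (C / x) / (2 * x) := by
          gcongr
          exact h₁ x ha1
      _ = C * (x ^ (2 * ξ) / x ^ 2) / 2 := by field_simp
      _ ≤ C * (x ^ (2 * ξ) / x ^ 2) := half_le_self (by positivity)
      _ ≤ _ := by gcongr

theorem isBigO_conj {f g : ℕ → ℂ} {h : ℕ → ℝ} (hf : f =O[atTop] h) (hg : ∀ n, g n = conj (f n)) :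
    g =O[atTop] h :=
  (IsBigO.of_bound 1 (Eventually.of_forall fun n => by
    rw [hg, Complex.norm_conj, one_mul])).trans hf

end GurtinPipkin

theorem theorem3
    (A B α β ξ r : ℝ) (hA : 0 < A) (hB : 0 < B) (hα₀ : 0 < α) (hα₁ : α ≤ 1)
    (hαβ : 1 < α + β) (hξ₀ : 0 < ξ) (hξ₁ : ξ < 1) (hr : r = (α + β - 1) / β)
    (a : ℕ → ℝ) (ha_pos : ∀ n, 0 < a n) (ha_tend : Tendsto a atTop atTop)
    (c γ : ℕ → ℝ) (hc_pos : ∀ k, 0 < c k) (hγ_pos : ∀ k, 0 < γ k) (hγ_mono : StrictMono γ)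
    (hc : (fun k : ℕ => c k - A * ((k : ℝ) + 1) ^ (-α)) =O[atTop]
      fun k : ℕ => ((k : ℝ) + 1) ^ (-α - 1))
    (hγ : (fun k : ℕ => γ k - B * ((k : ℝ) + 1) ^ β) =O[atTop]
      fun k : ℕ => ((k : ℝ) + 1) ^ (β - 1))
    (hsummable : Summable fun k => c k / γ k) (hsum : ∑' k, c k / γ k < 1)
    (p : ℕ) (hp : 1 ≤ p)
    (hgap : (fun k : ℕ => γ (k + 1) - γ k) =Θ[atTop]
      fun k : ℕ => ((k : ℝ) + 1) ^ (β - (p : ℝ))) :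
    (∃ (lam x : ℕ → ℕ → ℝ) (lamP lamM : ℕ → ℂ),
      -- structure of the zero set and interlacing
      (∀ᶠ n in atTop,
        {t : ℝ | (t : ℂ) ∈ GurtinPipkin.zerosOff γ (GurtinPipkin.fSym (a n) ξ c γ)}
            = Set.range (x n) ∧
        GurtinPipkin.zerosOff γ (GurtinPipkin.ell (a n) ξ c γ)
            = Set.range (fun k => (lam n k : ℂ)) ∪ {lamP n, lamM n} ∧
        (∀ k, -γ k < lam n k ∧ lam n k < x n k) ∧
        (∀ k, x n (k + 1) < -γ k) ∧
        x n 0 < 0 ∧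
        0 < (lamP n).im ∧
        lamM n = (starRingEnd ℂ) (lamP n)) ∧
      -- asymptotics of the complex-conjugate pair
      (r < 1 / 2 →
        ((fun n => lamP n - (Complex.I * (a n : ℂ)
            - GurtinPipkin.constD r * ((A / (β * B ^ (1 - r)) : ℝ) : ℂ)
              * ((a n ^ (-(1 + r - 2 * ξ)) : ℝ) : ℂ))) =O[atTop]
          fun n => a n ^ (-(2 * (r - ξ) + 1))) ∧
        ((fun n => lamM n - (-Complex.I * (a n : ℂ)
            - (starRingEnd ℂ) (GurtinPipkin.constD r) * ((A / (β * B ^ (1 - r)) : ℝ) : ℂ)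
              * ((a n ^ (-(1 + r - 2 * ξ)) : ℝ) : ℂ))) =O[atTop]
          fun n => a n ^ (-(2 * (r - ξ) + 1)))) ∧
      (1 / 2 ≤ r → r < 1 →
        ((fun n => lamP n - (Complex.I * (a n : ℂ)
            - GurtinPipkin.constD r * ((A / (β * B ^ (1 - r)) : ℝ) : ℂ)
              * ((a n ^ (-(1 + r - 2 * ξ)) : ℝ) : ℂ))) =O[atTop]
          fun n => a n ^ (-(2 * (1 - ξ)))) ∧
        ((fun n => lamM n - (-Complex.I * (a n : ℂ)
            - (starRingEnd ℂ) (GurtinPipkin.constD r) * ((A / (β * B ^ (1 - r)) : ℝ) : ℂ)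
              * ((a n ^ (-(1 + r - 2 * ξ)) : ℝ) : ℂ))) =O[atTop]
          fun n => a n ^ (-(2 * (1 - ξ))))) ∧
      (r = 1 →
        ((fun n => lamP n - (Complex.I * (a n : ℂ)
            - ((A / (2 * β) * a n ^ (-(2 * (1 - ξ))) * Real.log (a n) : ℝ) : ℂ))) =O[atTop]
          fun n => a n ^ (-(2 * (1 - ξ)))) ∧
        ((fun n => lamM n - (-Complex.I * (a n : ℂ)
            - ((A / (2 * β) * a n ^ (-(2 * (1 - ξ))) * Real.log (a n) : ℝ) : ℂ))) =O[atTop]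
          fun n => a n ^ (-(2 * (1 - ξ)))))) ∧
    -- the values of the constant `D`
    (r < 1 →
      GurtinPipkin.constD r =
        1 / 2 * (((∫ t in Set.Ioi (0 : ℝ), 1 / (t ^ r * (1 + t ^ 2)) : ℝ) : ℂ)
          + Complex.I * ((∫ t in Set.Ioi (0 : ℝ), 1 / (t ^ (r - 1) * (1 + t ^ 2)) : ℝ) : ℂ)) ∧
      GurtinPipkin.constD r =
        (Real.pi / 2 : ℂ) * Complex.exp (Complex.I * (Real.pi / 2) * (1 - (r : ℂ)))
          / ((Real.sin (Real.pi * r) : ℝ) : ℂ)) := by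
  have hβ : 0 < β := by linarith
  have hβr : β * r = α + β - 1 := by rw [hr]; field_simp
  have hr0 : 0 < r := by rw [hr]; exact div_pos (by linarith) hβ
  have ht := GurtinPipkin.tendsto_atTop_of_isBigO_sub_rpow hB hβ hγ
  refine ⟨?_, fun hr1 => ⟨GurtinPipkin.constD_eq_integrals hr0 hr1, GurtinPipkin.constD_eq_exp hr0 hr1⟩⟩
  obtain ⟨d, hd⟩ := Filter.skolem.1
    (ha_tend.eventually (GurtinPipkin.eventually_exists_zeros hc_pos hγ_pos hγ_mono ht hsummable hξ₁))
  have hw : ∀ᶠ n in atTop, ‖(d n).2.2 - (Complex.I * a n +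
      ((a n ^ (2 * ξ) : ℝ) : ℂ) * GurtinPipkin.Khat c γ (Complex.I * a n) / (2 * Complex.I * a n))‖ ≤
      24 * (a n ^ (2 * ξ)) ^ 2 * ‖GurtinPipkin.Khat c γ (Complex.I * a n)‖ ^ 2 / a n ^ 3 :=
    hd.mono fun n hn => hn.2.2.2.2.2.2
  -- Here `q = r`. The exponent `2ξ - 2r - 1` dominates both errors if `r ≤ 1/2`, and `2ξ - 2` does
  -- if `r ≥ 1/2`.
  have hlt : ∀ e, r < 1 → 2 * ξ - 2 ≤ e → 4 * ξ - 3 - 2 * r ≤ e →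
      ((fun n => (d n).2.2 - (Complex.I * (a n : ℂ)
            - GurtinPipkin.constD r * ((A / (β * B ^ (1 - r)) : ℝ) : ℂ)
              * ((a n ^ (-(1 + r - 2 * ξ)) : ℝ) : ℂ))) =O[atTop] fun n => a n ^ e) ∧
      ((fun n => (starRingEnd ℂ) (d n).2.2 - (-Complex.I * (a n : ℂ)
            - (starRingEnd ℂ) (GurtinPipkin.constD r) * ((A / (β * B ^ (1 - r)) : ℝ) : ℂ)
              * ((a n ^ (-(1 + r - 2 * ξ)) : ℝ) : ℂ))) =O[atTop] fun n => a n ^ e) := by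
    intro e hr1 he he'
    have hα : α < 1 := by nlinarith
    obtain ⟨C, hC⟩ := GurtinPipkin.exists_norm_Khat_sub_rpow_le hA hB hα₀ hβ hαβ hc_pos ht hsummable hc hγ hα hβr
    obtain ⟨C', hC'⟩ := GurtinPipkin.exists_norm_Khat_le_rpow hA hB hα₀ hβ hαβ hc_pos ht hsummable hc hγ hα hβr
    have h := GurtinPipkin.isBigO_nonreal_zero_sub (fun a ha => hC a (by linarith)) hC' he he' ha_tend hw
    have hP : (fun n => (d n).2.2 - (Complex.I * (a n : ℂ)
            - GurtinPipkin.constD r * ((A / (β * B ^ (1 - r)) : ℝ) : ℂ)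
              * ((a n ^ (-(1 + r - 2 * ξ)) : ℝ) : ℂ))) =O[atTop] fun n => a n ^ e := by
      -- The identity behind the algebra: `J / (2i) = -(i/2) J = -D`, where `J` is the integral in
      -- `constD`.
      refine h.congr_left fun n => ?_
      have ha := ha_pos n
      have hp : a n ^ (-(1 + r - 2 * ξ)) = a n ^ (2 * ξ) * a n ^ (-r) / a n := by
        rw [← Real.rpow_add ha, ← Real.rpow_sub_one ha.ne']
        ring_nf
      have haC : (a n : ℂ) ≠ 0 := Complex.ofReal_ne_zero.2 ha.ne'
      have hBC : ((B ^ (1 - r) : ℝ) : ℂ) ≠ 0 :=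
        Complex.ofReal_ne_zero.2 (Real.rpow_pos_of_pos hB _).ne'
      have hβC : (β : ℂ) ≠ 0 := Complex.ofReal_ne_zero.2 hβ.ne'
      rw [hp, GurtinPipkin.constD]
      generalize ∫ t in Set.Ioi (0 : ℝ), 1 / (((t ^ r : ℝ) : ℂ) * (Complex.I + (t : ℂ))) = J
      push_cast at hBC ⊢
      field_simp
      ring_nf
      simp only [Complex.I_sq]
      ring
    refine ⟨hP, GurtinPipkin.isBigO_conj hP fun n => ?_⟩
    simp only [map_sub, map_mul, Complex.conj_I, Complex.conj_ofReal]
  refine ⟨fun n => (d n).1, fun n => (d n).2.1, fun n => (d n).2.2,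
    fun n => (starRingEnd ℂ) (d n).2.2, ?_, fun h => ?_, fun _ h => ?_, fun h => ?_⟩
  · filter_upwards [hd] with n hn
    exact ⟨hn.1, hn.2.1, hn.2.2.1, hn.2.2.2.1, hn.2.2.2.2.1, hn.2.2.2.2.2.1, rfl⟩
  · exact hlt _ (by linarith) (by linarith) (by linarith)
  · exact hlt _ h (by linarith) (by linarith)
  · have hα : α = 1 := by
      rw [h] at hβr
      linarith
    obtain ⟨C, hC⟩ := GurtinPipkin.exists_norm_Khat_sub_log_le hA hB hα₀ hβ hαβ hc_pos ht hsummable hc hγ hα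
    obtain ⟨C', hC'⟩ :=
      GurtinPipkin.exists_norm_Khat_le_rpow_neg_half hA hB hα₀ hβ hαβ hc_pos ht hsummable hc hγ hα
    have h := GurtinPipkin.isBigO_nonreal_zero_sub (e := -(2 * (1 - ξ))) hC hC' (by linarith) (by linarith)
      ha_tend hw
    have hP : (fun n => (d n).2.2 - (Complex.I * (a n : ℂ)
            - ((A / (2 * β) * a n ^ (-(2 * (1 - ξ))) * Real.log (a n) : ℝ) : ℂ))) =O[atTop]
          fun n => a n ^ (-(2 * (1 - ξ))) := by
      refine h.congr_left fun n => ?_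
      have ha := ha_pos n
      have hp : a n ^ (-(2 * (1 - ξ))) = a n ^ (2 * ξ) / a n ^ 2 := by
        rw [← Real.rpow_two, ← Real.rpow_sub ha]
        ring_nf
      have haC : (a n : ℂ) ≠ 0 := Complex.ofReal_ne_zero.2 ha.ne'
      have hβC : (β : ℂ) ≠ 0 := Complex.ofReal_ne_zero.2 hβ.ne'
      rw [hp]
      push_cast
      field_simp
      ring_nf
      simp only [Complex.I_sq, Complex.I_pow_three]
      ring
    refine ⟨hP, GurtinPipkin.isBigO_conj hP fun n => ?_⟩
    simp only [map_sub, map_mul, Complex.conj_I, Complex.conj_ofReal]
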